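/- Let $d\in\mathbb N$ and let $\mathbb V=\bigcup_{n\ge 0}\{1,\dots,d\}^n$ be the rooted $d$-regular tree: vertices are finite words, the root is the empty word $\emptyset$, $|v|$ is the length of $v$, $v|_k$ is the word of the first $k$ letters of $v$, $u\le v$ means that $u$ is an initial segment of $v$, and $u<v$ means $u\le v$ and $|u|<|v|$. The root is given a colour $\alpha\in\{1,\dots,d\}$; the colour $c(v)$ of $v\neq\emptyset$ is its last letter. For $u\le v$ and $i,j\in\{1,\dots,d\}$ let $N_{ij}[u;v]$ be the number of $k$ with $|u|\le k<|v|$, $c(v|_k)=i$ and $c(v|_{k+1})=j$. Let $\eta=(\eta_{ij})_{1\le i,j\le d}$ be a random matrix whose entries are almost surely non-negative and integrable (and may depend on each other). Put $\mathbf m(x)=(\mathbb E\,\eta_{ij}^x)_{i,j}$ for $x\in[0,1]$, with $0^0=1$, and assume that $\mathbf m$ is regular: there is an integer $M$ such that all entries of $\mathbf m(x)^M$ are strictly positive for every $x\in[0,1]$ (this is automatic if $\mathbb P(\eta_{ij}>0)=1$ for all $i,j$). Let $\rho(x)$ be the largest eigenvalue of $\mathbf m(x)$ and $\lambda=\inf_{x\in[0,1]}\rho(x)$.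 An edge environment on the $\alpha$-rooted tree is a family of random variables $\xi_{v}$, $v\in\mathbb V\setminus\{\emptyset\}$ (where $\xi_v$ is attached to the edge joining $v$ to its parent), such that, for every vertex $u$ and every letter $j$, $\xi_{uj}$ has the law of $\eta_{c(u)j}$, and such that the vectors $(\xi_{u1},\dots,\xi_{ud})$, $u\in\mathbb V$, are independent of each other. For $u\le v$ put $\xi[u;v]=\prod_{|u|\le k<|v|}\xi_{v|_{k+1}}$. A direction is a $d\times d$ matrix $\beta$ with $\beta_{ij}\ge 0$, $\sum_{i,j}\beta_{ij}=1$ and $\sum_j\beta_{ij}=\sum_j\beta_{ji}$ for all $i$; it is rational if all its entries are. Put $$\psi(\beta)=\prod_{i,k=1}^d\Bigl(\frac{\sum_j\beta_{ij}}{\beta_{ik}}\Bigr)^{\beta_{ik}},$$ where a factor with $\beta_{ik}=0$ equals $1$. For $\gamma\ge1$ and a matrix $\nu$ of non-negative integers, let $\mathbb U_\gamma(\nu)$ be the subtree of all vertices $v$ for which there is $w\ge v$ with $|w|$ a multiple of $\gamma$ and $N_{ij}[w|_{l\gamma};w|_{(l+1)\gamma}]=\nu_{ij}$ for all $i,j$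 and all $l\ge0$ with $(l+1)\gamma\le|w|$. **Proposition.** If $\lambda>1$, then there exist a rational direction $\hat\beta$, integers $N,\gamma\ge1$ such that $\nu_{ij}:=\hat\beta_{ij}\gamma$ is an integer for all $i,j$, and a real $y\in\,]0,1]$, all depending only on $d$ and the law of $\eta$, such that for every root colour $\alpha$ the subtree $\mathbb U_\gamma(\nu)$ is infinite and, for every edge environment on the $\alpha$-rooted tree, every $k\ge N$ and all $u,v\in\mathbb U_\gamma(\nu)$ with $u<v$ and $|v|-|u|=k\gamma$, $$\mathbb P\bigl(\xi[u;v]>y^{\gamma k}\bigr)>\Bigl(\frac{1}{y\,\psi(\hat\beta)}\Bigr)^{\gamma k}.$$ -/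

import Mathlib

open MeasureTheory ProbabilityTheory

namespace ColouredTree

/-- Vertices of the rooted regular tree of order `d`: finite words over an alphabet of `d`
letters. The root is the empty word, the children of `u` are the words `u ++ [j]`, `|u|` is
`u.length`, `u ≤ v` is `u <+: v`, and the truncation of `v` to its first `k` letters is `v.take k`.
The edge with most remote vertex `v ≠ []` is indexed by `v`. -/
abbrev Vertex (d : ℕ) : Type := List (Fin d)

/-- The colour of a vertex is its last letter; the root has the prescribed colour `α`. -/
def colour {d : ℕ} (α : Fin d) (u : Vertex d) : Fin d := u.getLastD α

/-- `N_{ij}[u;v]` (for `u ≤ v`): the number of edges of chromatic type `(i, j)` on the path from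
`u` to `v`. -/
def edgeCount {d : ℕ} (α : Fin d) (u v : Vertex d) (i j : Fin d) : ℕ :=
  ((Finset.Ico u.length v.length).filter
    (fun k => colour α (v.take k) = i ∧ colour α (v.take (k + 1)) = j)).card

/-- `ξ[u;v]` (for `u ≤ v`): the product of the edge variables along the path from `u` to `v`. -/
def pathProd {d : ℕ} {Ω : Type*} (ξ : Vertex d → Ω → ℝ) (u v : Vertex d) (ω : Ω) : ℝ :=
  ∏ k ∈ Finset.Ico u.length v.length, ξ (v.take (k + 1)) ω

/-- `ξ` is an edge environment of the `α`-rooted coloured tree with random matrix `η`: the variable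
`ξ (u ++ [j])` on the edge from `u` to its child `u ++ [j]` is a copy of `η i j`, where `i` is the
colour of `u`, and the vectors `(ξ (u ++ [j]))_j` attached to the different vertices `u` are
independent. Variables on sibling edges may depend on each other in any way. The value
`ξ []` is not attached to any edge and plays no role. -/
structure IsEdgeEnvironment {d : ℕ} {Ω' Ω : Type*} [MeasurableSpace Ω'] [MeasurableSpace Ω]
    (α : Fin d) (η : Fin d → Fin d → Ω' → ℝ) (P' : Measure Ω')
    (ξ : Vertex d → Ω → ℝ) (P : Measure Ω) : Prop where
  identDistrib : ∀ (u : Vertex d) (j : Fin d),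
    IdentDistrib (ξ (u ++ [j])) (η (colour α u) j) P P'
  indep : iIndepFun (fun (u : Vertex d) (ω : Ω) (j : Fin d) => ξ (u ++ [j]) ω) P

/-- The moment matrix `m(x) = (E η_{ij}^x)_{ij}`. -/
noncomputable def momentMatrix {d : ℕ} {Ω' : Type*} [MeasurableSpace Ω']
    (η : Fin d → Fin d → Ω' → ℝ) (P' : Measure Ω') (x : ℝ) : Matrix (Fin d) (Fin d) ℝ :=
  Matrix.of fun i j => ∫ ω, (η i j ω) ^ x ∂P'

/-- The moment matrices are regular: some common power of all `m(x)`, `x ∈ [0,1]`, has strictly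
positive entries. -/
def IsRegular {d : ℕ} {Ω' : Type*} [MeasurableSpace Ω']
    (η : Fin d → Fin d → Ω' → ℝ) (P' : Measure Ω') : Prop :=
  ∃ N : ℕ, ∀ x ∈ Set.Icc (0 : ℝ) 1, ∀ i j, 0 < (momentMatrix η P' x ^ N) i j

/-- The largest (real) eigenvalue of a real matrix. -/
noncomputable def largestEigenvalue {d : ℕ} (A : Matrix (Fin d) (Fin d) ℝ) : ℝ :=
  sSup {μ : ℝ | Module.End.HasEigenvalue (Matrix.toLin' A) μ}

/-- `λ = inf_{x ∈ [0,1]} ρ(x)`, where `ρ(x)` is the largest eigenvalue of `m(x)`. -/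
noncomputable def lam {d : ℕ} {Ω' : Type*} [MeasurableSpace Ω']
    (η : Fin d → Fin d → Ω' → ℝ) (P' : Measure Ω') : ℝ :=
  ⨅ x : Set.Icc (0 : ℝ) 1, largestEigenvalue (momentMatrix η P' (x : ℝ))

/-- Directions: non-negative matrices with total sum one whose row sums equal their column sums. -/
structure IsDirection {d : ℕ} (β : Matrix (Fin d) (Fin d) ℝ) : Prop where
  nonneg : ∀ i j, 0 ≤ β i j
  sum_eq_one : ∑ i, ∑ j, β i j = 1
  balanced : ∀ i, ∑ j, β i j = ∑ j, β j i

/-- `ψ(β) = ∏_{i,k} ((∑_j β_{ij}) / β_{ik}) ^ β_{ik}`; factors with `β_{ik} = 0` are equal to `1`. -/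
noncomputable def psi {d : ℕ} (β : Matrix (Fin d) (Fin d) ℝ) : ℝ :=
  ∏ i, ∏ k, ((∑ j, β i j) / β i k) ^ (β i k)

/-- The subtree `U_γ(ν)` of the `α`-rooted tree: the vertices lying on those paths from the root
that have, between any two levels `lγ` and `(l+1)γ`, exactly `ν i j` edges of every type `(i, j)`. -/
def subtree {d : ℕ} (α : Fin d) (γ : ℕ) (ν : Matrix (Fin d) (Fin d) ℕ) : Set (Vertex d) :=
  {v | ∃ w : Vertex d, v <+: w ∧ γ ∣ w.length ∧
    ∀ l : ℕ, (l + 1) * γ ≤ w.length →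
      ∀ i j, edgeCount α (w.take (l * γ)) (w.take ((l + 1) * γ)) i j = ν i j}

end ColouredTree

/-! Along a path of the subtree the number of steps of each type is prescribed up to one block, so
the probability can be bounded below by the method of types. Group the values of `η i j` into
finitely many cells, cell `s` having lower bound `a s` and probability `p i j s`, and prescribe also
the number `c i j s` of edges of type `(i, j)` per block whose variable falls in cell `s`. Such a
configuration collects `exp L` per block, with `L = ∑ c log a`, and by Stirling has probability
about `exp H` per block. The entropy `G` of the flow `c` relative to `p` satisfies `G = H + γ log
ψ(β)`. With `γ log y` slightly below `min 0 L`, the claim reduces to `G + min 0 L > 0`, that is, to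
`G > 0` and `G + L > 0`: this is `IsGoodFlow`, and `IsGoodFlow.exists_rate` does the reduction.

Good flows come from a variational principle (`exists_goodFlow`). The Gibbs flow built from the
Perron vectors of the matrix `∑ s, p i j s * a s ^ x` satisfies `G + x L = T log r`, where `r` is
the Perron value and `T` the total mass. If `L = 0` for some `x`, then `G = G + L = T log r > 0`.
Otherwise `L > 0` near the left end of the exponent interval or `L < 0` at `x = 1`, and that
endpoint works.

The remaining ingredients: `exists_grid` makes the cells fine enough to keep all Perron values above
one, `IsGoodFlow.exists_nat` makes the flow integral, `exists_eulerian_walk` realizes a multiple of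
it by closed walks, so that the subtree is infinite, and `factorial_mul_le_real_prod` is the method
of types. -/

namespace ColouredTree

/-! ### Perron–Frobenius theory of primitive matrices -/

section Perron

open Matrix

variable {ι : Type*} [Fintype ι]

lemma mulVec_pos {A : Matrix ι ι ℝ} (hA : ∀ i j, 0 < A i j) {v : ι → ℝ}
    (hv : ∀ i, 0 ≤ v i) (hv0 : v ≠ 0) (i : ι) : 0 < (A *ᵥ v) i := by
  obtain ⟨j, hj⟩ := Function.ne_iff.1 hv0
  exact Finset.sum_pos' (fun k _ => mul_nonneg (hA i k).le (hv k))
    ⟨j, Finset.mem_univ j, mul_pos (hA i j) (lt_of_le_of_ne (hv j) (Ne.symm hj))⟩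

/-- Evaluate `u A w` in two ways: it lies between `t (u ⬝ᵥ w)` and `r (u ⬝ᵥ w)`. -/
lemma eigenvalue_le_of_subsolution {A : Matrix ι ι ℝ} {u w : ι → ℝ} {r t : ℝ}
    (hu : ∀ i, 0 ≤ u i) (hw : ∀ i, 0 ≤ w i) (huw : 0 < u ⬝ᵥ w)
    (h1 : ∀ j, (u ᵥ* A) j ≤ r * u j) (h2 : ∀ i, t * w i ≤ (A *ᵥ w) i) : t ≤ r := by
  refine le_of_mul_le_mul_right ?_ huw
  calc t * (u ⬝ᵥ w) = ∑ i, u i * (t * w i) := by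
        simp only [dotProduct, Finset.mul_sum]
        exact Finset.sum_congr rfl fun i _ => by ring
    _ ≤ u ⬝ᵥ (A *ᵥ w) := Finset.sum_le_sum fun i _ => mul_le_mul_of_nonneg_left (h2 i) (hu i)
    _ = (u ᵥ* A) ⬝ᵥ w := dotProduct_mulVec u A w
    _ ≤ ∑ i, (r * u i) * w i :=
        Finset.sum_le_sum fun i _ => mul_le_mul_of_nonneg_right (h1 i) (hw i)
    _ = r * (u ⬝ᵥ w) := by
        simp only [dotProduct, Finset.mul_sum]
        exact Finset.sum_congr rfl fun i _ => by ring

lemma dotProduct_pos [Nonempty ι] {u w : ι → ℝ} (hu : ∀ i, 0 < u i) (hw : ∀ i, 0 < w i) :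
    0 < u ⬝ᵥ w :=
  Finset.sum_pos (fun i _ => mul_pos (hu i) (hw i)) Finset.univ_nonempty

lemma perron_value_eq [Nonempty ι] {A : Matrix ι ι ℝ} {u w : ι → ℝ} {r t : ℝ}
    (hu : ∀ i, 0 < u i) (hw : ∀ i, 0 < w i) (h1 : u ᵥ* A = r • u) (h2 : A *ᵥ w = t • w) :
    t = r := by
  have h := dotProduct_mulVec u A w
  rw [h1, h2, dotProduct_smul, smul_dotProduct] at h
  exact mul_right_cancel₀ (dotProduct_pos hu hw).ne' h

variable [DecidableEq ι]

lemma pow_mulVec_eigen {A : Matrix ι ι ℝ} {r : ℝ} {w : ι → ℝ} (h : A *ᵥ w = r • w) (n : ℕ) :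
    (A ^ n) *ᵥ w = r ^ n • w := by
  induction n with
  | zero => simp
  | succ n ih => rw [pow_succ, ← mulVec_mulVec, h, mulVec_smul, ih, smul_smul, pow_succ, mul_comm]

lemma eigenvector_pos {A : Matrix ι ι ℝ} {n : ℕ} (hn : ∀ i j, 0 < (A ^ n) i j) {r : ℝ}
    {w : ι → ℝ} (hw : w ∈ stdSimplex ℝ ι) (h : A *ᵥ w = r • w) (i : ι) : 0 < w i := by
  have hw0 : w ≠ 0 := by
    rintro rfl
    simpa using hw.2
  have h1 := mulVec_pos hn hw.1 hw0 i
  rw [pow_mulVec_eigen h] at h1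
  refine lt_of_le_of_ne (hw.1 i) fun h0 => ?_
  simp [← h0] at h1

/-- Existence of the Perron eigenvector of a primitive matrix. -/
lemma exists_perron [Nonempty ι] {A : Matrix ι ι ℝ} (hA : ∀ i j, 0 ≤ A i j) {n : ℕ}
    (hn : ∀ i j, 0 < (A ^ n) i j) : ∃ w ∈ stdSimplex ℝ ι, ∃ r : ℝ, A *ᵥ w = r • w := by
  set C : ℝ := ∑ i, ∑ j, A i j
  -- Collatz–Wielandt: the Perron value is the largest `r` with `r w ≤ A w` for some `w` in the
  -- simplex. Summing coordinates shows that every such `r` is at most `C`, so the cap costs nothing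
  -- and gives compactness.
  set K : Set ((ι → ℝ) × ℝ) :=
    (stdSimplex ℝ ι ×ˢ Set.Icc 0 C) ∩ {q | ∀ i, q.2 * q.1 i ≤ (A *ᵥ q.1) i} with hK
  have hKc : IsCompact K := by
    refine ((isCompact_stdSimplex ℝ ι).prod isCompact_Icc).inter_right ?_
    simp only [Set.ofPred_forall]
    refine isClosed_iInter fun i => isClosed_le (by fun_prop) ?_
    simp only [mulVec, dotProduct]
    fun_prop
  have hC0 : 0 ≤ C := Finset.sum_nonneg fun i _ => Finset.sum_nonneg fun j _ => hA i j
  have hKn : K.Nonempty := by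
    obtain ⟨i⟩ := ‹Nonempty ι›
    refine ⟨(Pi.single i 1, 0), ⟨single_mem_stdSimplex ℝ i, le_rfl, hC0⟩, fun j => ?_⟩
    simp [hA]
  obtain ⟨⟨w, r⟩, ⟨⟨hw, hr⟩, hwr⟩, hmax⟩ :=
    hKc.exists_isMaxOn hKn (f := fun q => q.2) (by fun_prop)
  simp only [Set.mem_ofPred_eq] at hw hr hwr
  have hfeas : ∀ w' ∈ stdSimplex ℝ ι, ∀ t, 0 ≤ t → (∀ i, t * w' i ≤ (A *ᵥ w') i) → t ≤ r := by
    intro w' hw' t ht h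
    refine hmax (a := (w', t)) ⟨⟨hw', ht, ?_⟩, h⟩
    calc t = ∑ i, t * w' i := by rw [← Finset.mul_sum, hw'.2, mul_one]
      _ ≤ ∑ i, (A *ᵥ w') i := Finset.sum_le_sum fun i _ => h i
      _ ≤ C := Finset.sum_le_sum fun i _ => Finset.sum_le_sum fun j _ =>
          mul_le_of_le_one_right (hA i j)
            (hw'.2 ▸ Finset.single_le_sum (fun k _ => hw'.1 k) (Finset.mem_univ j))
  refine ⟨w, hw, r, ?_⟩
  by_contra hne
  have hw0 : w ≠ 0 := by
    rintro rfl
    simpa using hw.2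
  have hv0 : A *ᵥ w - r • w ≠ 0 := sub_ne_zero.2 hne
  have hv : ∀ i, 0 ≤ (A *ᵥ w - r • w) i := fun i => by
    simpa using hwr i
  have h1 := mulVec_pos hn hv hv0
  have h2 := mulVec_pos hn hw.1 hw0
  set w' := (A ^ n) *ᵥ w with hw'
  have h3 : ∀ i, r * w' i < (A *ᵥ w') i := fun i => by
    have := h1 i
    rw [mulVec_sub, mulVec_smul, mulVec_mulVec, ← pow_succ, pow_succ', ← mulVec_mulVec] at this
    simpa only [Pi.sub_apply, Pi.smul_apply, smul_eq_mul, sub_pos] using this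
  obtain ⟨i0, -, hi0⟩ := Finset.exists_min_image Finset.univ (fun i => (A *ᵥ w') i / w' i)
    Finset.univ_nonempty
  have hs : 0 < ∑ i, w' i := Finset.sum_pos (fun i _ => h2 i) Finset.univ_nonempty
  have h4 : r < (A *ᵥ w') i0 / w' i0 := (lt_div_iff₀ (h2 i0)).2 (h3 i0)
  refine absurd (hfeas ((∑ i, w' i)⁻¹ • w') ⟨fun i => ?_, ?_⟩ ((A *ᵥ w') i0 / w' i0)
    (hr.1.trans h4.le) fun i => ?_) (not_le.2 h4)
  · exact mul_nonneg (inv_nonneg.2 hs.le) (h2 i).le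
  · simp only [Pi.smul_apply, smul_eq_mul, ← Finset.mul_sum]
    exact inv_mul_cancel₀ hs.ne'
  · rw [mulVec_smul, Pi.smul_apply, Pi.smul_apply, smul_eq_mul, smul_eq_mul, mul_left_comm]
    exact mul_le_mul_of_nonneg_left ((le_div_iff₀ (h2 i)).1 (hi0 i (Finset.mem_univ i)))
      (inv_nonneg.2 hs.le)

/-- Subtract the largest multiple of `w'` that stays below `w`. The difference is a non-negative
eigenvector with a zero coordinate, which positivity of `A ^ n` allows only if it vanishes;
normalization then makes the multiple equal to one. -/
lemma perron_unique [Nonempty ι] {A : Matrix ι ι ℝ} {n : ℕ} (hn : ∀ i j, 0 < (A ^ n) i j)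
    {w w' : ι → ℝ} {r : ℝ} (hw : w ∈ stdSimplex ℝ ι) (hw' : w' ∈ stdSimplex ℝ ι)
    (h : A *ᵥ w = r • w) (h' : A *ᵥ w' = r • w') : w = w' := by
  have hp := eigenvector_pos hn hw h
  have hp' := eigenvector_pos hn hw' h'
  obtain ⟨i0, -, hi0⟩ := Finset.exists_min_image Finset.univ (fun i => w i / w' i)
    Finset.univ_nonempty
  set t := w i0 / w' i0 with ht
  have hv : ∀ i, 0 ≤ (w - t • w') i := fun i => by
    simpa using (le_div_iff₀ (hp' i)).1 (hi0 i (Finset.mem_univ i))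
  have hv0 : (w - t • w') i0 = 0 := by
    simp [ht, div_mul_cancel₀ _ (hp' i0).ne']
  have he : A *ᵥ (w - t • w') = r • (w - t • w') := by
    rw [mulVec_sub, mulVec_smul, h, h', smul_sub, smul_comm]
  have hz : w - t • w' = 0 := by
    by_contra hne
    have h1 := mulVec_pos hn hv hne i0
    rw [pow_mulVec_eigen he, Pi.smul_apply, hv0, smul_zero] at h1
    exact lt_irrefl _ h1
  have hwt : w = t • w' := sub_eq_zero.1 hz
  have h1 : t = 1 := by
    have := hw.2
    rw [hwt] at this
    simpa [← Finset.mul_sum, hw'.2] using this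
  rw [hwt, h1, one_smul]

lemma pow_apply_le_pow_apply {A B : Matrix ι ι ℝ} (hA : ∀ i j, 0 ≤ A i j)
    (hAB : ∀ i j, A i j ≤ B i j) (n : ℕ) :
    ∀ i j, 0 ≤ (A ^ n) i j ∧ (A ^ n) i j ≤ (B ^ n) i j := by
  induction n with
  | zero =>
    intro i j
    simp only [pow_zero, le_refl, and_true, one_apply]
    split_ifs <;> norm_num
  | succ n ih =>
    intro i j
    simp only [pow_succ, mul_apply]
    exact ⟨Finset.sum_nonneg fun k _ => mul_nonneg (ih i k).1 (hA k j),
      Finset.sum_le_sum fun k _ => mul_le_mul (ih i k).2 (hAB k j) (hA k j)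
        ((ih i k).1.trans (ih i k).2)⟩

end Perron

/-! ### Gibbs flows and the variational principle -/

section Gibbs

open Matrix

variable {ι S : Type*} [Fintype ι] [Fintype S]

/-- The total weight of the transition `i → j` when it carries symbols `s` with masses `p i j s`
and values `a s`, raised to the power `x`. -/
noncomputable def symbolMatrix (p : ι → ι → S → ℝ) (a : S → ℝ) (x : ℝ) : Matrix ι ι ℝ :=
  Matrix.of fun i j => ∑ s, p i j s * a s ^ x

/-- The relative entropy rate of a flow `τ` with respect to the masses `p`. -/
noncomputable def flowEntropy (p τ : ι → ι → S → ℝ) : ℝ :=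
  ∑ i, ∑ j, ∑ s, τ i j s * Real.log ((∑ k, ∑ t, τ i k t) * p i j s / τ i j s)

/-- The logarithm of the total value collected by a flow `τ`. -/
noncomputable def flowDrift (a : S → ℝ) (τ : ι → ι → S → ℝ) : ℝ :=
  ∑ i, ∑ j, ∑ s, τ i j s * Real.log (a s)

/-- The stationary flow of the Gibbs measure with eigenvectors `u` and `w`. -/
noncomputable def gibbsFlow (p : ι → ι → S → ℝ) (a : S → ℝ) (x : ℝ) (u w : ι → ℝ) :
    ι → ι → S → ℝ :=
  fun i j s => u i * (p i j s * a s ^ x) * w j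

variable {p : ι → ι → S → ℝ} {a : S → ℝ} {x r : ℝ} {u w : ι → ℝ}

lemma gibbsFlow_row (hw : symbolMatrix p a x *ᵥ w = r • w) (i : ι) :
    ∑ j, ∑ s, gibbsFlow p a x u w i j s = r * (u i * w i) := by
  have := congrFun hw i
  simp only [mulVec, dotProduct, symbolMatrix, of_apply, Pi.smul_apply, smul_eq_mul] at this
  simp only [gibbsFlow, mul_left_comm r, ← this, Finset.mul_sum, Finset.sum_mul, mul_assoc]

lemma gibbsFlow_col (hu : u ᵥ* symbolMatrix p a x = r • u) (j : ι) :
    ∑ i, ∑ s, gibbsFlow p a x u w i j s = r * (u j * w j) := by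
  have := congrFun hu j
  simp only [vecMul, dotProduct, symbolMatrix, of_apply, Pi.smul_apply, smul_eq_mul] at this
  simp only [gibbsFlow, ← mul_assoc r, ← this, Finset.mul_sum, Finset.sum_mul]

/-- On the support, each logarithm in the entropy equals `log r + log (w i) - log (w j) - x log (a
s)`. Row and column sums of the flow agree, so the `w` terms cancel in the sum. -/
lemma gibbsFlow_entropy (ha : ∀ s, 0 < a s) (hp : ∀ i j s, 0 ≤ p i j s) (hr : 0 < r)
    (hu0 : ∀ i, 0 < u i) (hw0 : ∀ i, 0 < w i)
    (hw : symbolMatrix p a x *ᵥ w = r • w) (hu : u ᵥ* symbolMatrix p a x = r • u) :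
    flowEntropy p (gibbsFlow p a x u w) + x * flowDrift a (gibbsFlow p a x u w) =
      (∑ i, r * (u i * w i)) * Real.log r := by
  have key : ∀ i j s, gibbsFlow p a x u w i j s *
      Real.log ((∑ k, ∑ t, gibbsFlow p a x u w i k t) * p i j s / gibbsFlow p a x u w i j s) +
      x * (gibbsFlow p a x u w i j s * Real.log (a s)) =
      gibbsFlow p a x u w i j s * Real.log r + gibbsFlow p a x u w i j s * Real.log (w i) -
      gibbsFlow p a x u w i j s * Real.log (w j) := by
    intro i j s
    rw [gibbsFlow_row hw]
    rcases (hp i j s).eq_or_lt with h0 | h0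
    · simp [gibbsFlow, ← h0]
    have h1 := Real.rpow_pos_of_pos (ha s) x
    have h2 : r * (u i * w i) * p i j s / gibbsFlow p a x u w i j s =
        r * w i / (a s ^ x * w j) := by
      have := (hu0 i).ne'
      have := (hw0 j).ne'
      simp only [gibbsFlow]
      field_simp
    rw [h2, Real.log_div (mul_pos hr (hw0 i)).ne' (mul_pos h1 (hw0 j)).ne',
      Real.log_mul hr.ne' (hw0 i).ne', Real.log_mul h1.ne' (hw0 j).ne', Real.log_rpow (ha s)]
    ring
  simp only [flowEntropy, flowDrift, Finset.mul_sum, ← Finset.sum_add_distrib, key]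
  simp only [Finset.sum_sub_distrib, Finset.sum_add_distrib]
  have e1 : ∑ i, ∑ j, ∑ s, gibbsFlow p a x u w i j s * Real.log r =
      (∑ i, r * (u i * w i)) * Real.log r := by
    simp only [← Finset.sum_mul, gibbsFlow_row hw]
  have e2 : ∑ i, ∑ j, ∑ s, gibbsFlow p a x u w i j s * Real.log (w i) =
      ∑ i, r * (u i * w i) * Real.log (w i) := by
    simp only [← Finset.sum_mul, gibbsFlow_row hw]
  have e3 : ∑ i, ∑ j, ∑ s, gibbsFlow p a x u w i j s * Real.log (w j) =
      ∑ i, r * (u i * w i) * Real.log (w i) := by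
    rw [Finset.sum_comm]
    simp only [← Finset.sum_mul, gibbsFlow_col hu]
  rw [e1, e2, e3]
  ring

/-- The conclusion of the variational principle: a balanced flow with the same support as `p` whose
entropy dominates the loss along it. -/
def IsGoodFlow (p : ι → ι → S → ℝ) (a : S → ℝ) (τ : ι → ι → S → ℝ) : Prop :=
  (∀ i j s, 0 ≤ τ i j s) ∧ (∀ i j s, τ i j s = 0 ↔ p i j s = 0) ∧
    (∀ i, ∑ j, ∑ s, τ i j s = ∑ j, ∑ s, τ j i s) ∧
    0 < flowEntropy p τ ∧ 0 < flowEntropy p τ + flowDrift a τ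

/-- Let `G`, `L`, `T` be entropy, drift and mass, so that `G + x L = T log r > 0`. If `L = 0`, both
conditions are immediate. If `x = 1` and `L ≤ 0`, then `G ≥ G + L = T log r`. If `x = x₀` and `L ≥
0`, then `G + L ≥ G`, and `G > 0` because `x₀ L ≤ T x₀ log κ < T log r₀`. -/
lemma gibbsFlow_good [Nonempty ι] {x₀ r₀ κ : ℝ} (ha : ∀ s, 0 < a s) (haκ : ∀ s, a s ≤ κ)
    (hp : ∀ i j s, 0 ≤ p i j s) (hr₀ : 1 < r₀) (hr : r₀ ≤ r) (hx₀ : 0 ≤ x₀)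
    (hκ : x₀ * Real.log κ < Real.log r₀)
    (hu0 : ∀ i, 0 < u i) (hw0 : ∀ i, 0 < w i)
    (hw : symbolMatrix p a x *ᵥ w = r • w) (hu : u ᵥ* symbolMatrix p a x = r • u)
    (h : (0 ≤ flowDrift a (gibbsFlow p a x u w) ∧ x = x₀) ∨
      (flowDrift a (gibbsFlow p a x u w) ≤ 0 ∧ x = 1) ∨
      flowDrift a (gibbsFlow p a x u w) = 0) :
    IsGoodFlow p a (gibbsFlow p a x u w) := by
  have hr1 : 1 < r := hr₀.trans_le hr
  have hr0 : 0 < r := zero_lt_one.trans hr1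
  have hT : 0 < ∑ i, r * (u i * w i) :=
    Finset.sum_pos (fun i _ => mul_pos hr0 (mul_pos (hu0 i) (hw0 i))) Finset.univ_nonempty
  have hG := gibbsFlow_entropy ha hp hr0 hu0 hw0 hw hu
  have hnn : ∀ i j s, 0 ≤ gibbsFlow p a x u w i j s := fun i j s =>
    mul_nonneg (mul_nonneg (hu0 i).le (mul_nonneg (hp i j s) (Real.rpow_nonneg (ha s).le x)))
      (hw0 j).le
  have hL : flowDrift a (gibbsFlow p a x u w) ≤ (∑ i, r * (u i * w i)) * Real.log κ := by
    simp only [← gibbsFlow_row hw, Finset.sum_mul, flowDrift]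
    exact Finset.sum_le_sum fun i _ => Finset.sum_le_sum fun j _ => Finset.sum_le_sum fun s _ =>
      mul_le_mul_of_nonneg_left (Real.log_le_log (ha s) (haκ s)) (hnn i j s)
  have hlr : Real.log r₀ ≤ Real.log r := Real.log_le_log (zero_lt_one.trans hr₀) hr
  have hTr : 0 < (∑ i, r * (u i * w i)) * Real.log r := mul_pos hT (Real.log_pos hr1)
  refine ⟨hnn, fun i j s => ?_, fun i => ?_, ?_⟩
  · have := (hu0 i).ne'
    have := (hw0 j).ne'
    have := (Real.rpow_pos_of_pos (ha s) x).ne'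
    simp_all [gibbsFlow]
  · rw [gibbsFlow_row hw, gibbsFlow_col hu]
  rcases h with ⟨h, rfl⟩ | ⟨h, rfl⟩ | h
  · have h1 : 0 < (∑ i, r * (u i * w i)) * (Real.log r₀ - x * Real.log κ) :=
      mul_pos hT (by linarith)
    have h2 := mul_le_mul_of_nonneg_left hL hx₀
    have h3 := mul_le_mul_of_nonneg_left hlr hT.le
    constructor <;> nlinarith
  · constructor <;> linarith
  · rw [h] at hG ⊢
    constructor <;> linarith

/-- A variational principle: if the Perron value of all the matrices `symbolMatrix p a x`,
`x₀ ≤ x ≤ 1`, is larger than `1`, then there is a good flow. -/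
lemma exists_goodFlow [DecidableEq ι] [Nonempty ι] {x₀ r₀ κ : ℝ} (ha : ∀ s, 0 < a s)
    (haκ : ∀ s, a s ≤ κ) (hp : ∀ i j s, 0 ≤ p i j s) (hr₀ : 1 < r₀) (hx₀ : 0 ≤ x₀) (hx₁ : x₀ ≤ 1)
    (hκ : x₀ * Real.log κ < Real.log r₀) {n : ℕ}
    (hn : ∀ x ∈ Set.Icc x₀ 1, ∀ i j, 0 < (symbolMatrix p a x ^ n) i j)
    (hval : ∀ x ∈ Set.Icc x₀ 1, ∀ (u : ι → ℝ) (r : ℝ), (∀ i, 0 < u i) →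
      u ᵥ* symbolMatrix p a x = r • u → r₀ ≤ r) :
    ∃ τ, IsGoodFlow p a τ := by
  have hcont : Continuous fun x => symbolMatrix p a x := by
    refine continuous_matrix fun i j => ?_
    exact continuous_finsetSum _ fun s _ =>
      continuous_const.mul (Real.continuous_const_rpow (ha s).ne')
  have hB0 : ∀ x i j, 0 ≤ symbolMatrix p a x i j := fun x i j =>
    Finset.sum_nonneg fun s _ => mul_nonneg (hp i j s) (Real.rpow_nonneg (ha s).le x)
  have hnT : ∀ x ∈ Set.Icc x₀ 1, ∀ i j, 0 < ((symbolMatrix p a x)ᵀ ^ n) i j := by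
    intro x hx i j
    rw [← transpose_pow]
    exact hn x hx j i
  set Δ := stdSimplex ℝ ι
  -- The right and left Perron vectors over all exponents. For vectors of the simplex the eigenvalue
  -- is the coordinate sum of the image, so being an eigenvector is a closed condition.
  set E : Set (ℝ × (ι → ℝ) × (ι → ℝ)) := (Set.Icc x₀ 1 ×ˢ Δ ×ˢ Δ) ∩
    {q | symbolMatrix p a q.1 *ᵥ q.2.1 = (∑ i, (symbolMatrix p a q.1 *ᵥ q.2.1) i) • q.2.1 ∧
      q.2.2 ᵥ* symbolMatrix p a q.1 = (∑ i, (q.2.2 ᵥ* symbolMatrix p a q.1) i) • q.2.2} with hE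
  have hEc : IsCompact E := by
    have h1 : Continuous fun q : ℝ × (ι → ℝ) × (ι → ℝ) => symbolMatrix p a q.1 *ᵥ q.2.1 :=
      (hcont.comp continuous_fst).matrix_mulVec (by fun_prop)
    have h2 : Continuous fun q : ℝ × (ι → ℝ) × (ι → ℝ) => q.2.2 ᵥ* symbolMatrix p a q.1 :=
      Continuous.matrix_vecMul (by fun_prop) (hcont.comp continuous_fst)
    refine (isCompact_Icc.prod ((isCompact_stdSimplex ℝ ι).prod
      (isCompact_stdSimplex ℝ ι))).inter_right ?_
    exact (isClosed_eq h1 (by fun_prop)).inter (isClosed_eq h2 (by fun_prop))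
  have hfull : ∀ x w u, (x, w, u) ∈ E → x ∈ Set.Icc x₀ 1 ∧ (∀ i, 0 < u i) ∧ (∀ i, 0 < w i) ∧
      ∃ r, r₀ ≤ r ∧ symbolMatrix p a x *ᵥ w = r • w ∧ u ᵥ* symbolMatrix p a x = r • u := by
    rintro x w u ⟨⟨hx, hw, hu⟩, h1, h2⟩
    simp only at hx hw hu h1 h2
    have hw0 := eigenvector_pos (hn x hx) hw h1
    have hu0 := eigenvector_pos (hnT x hx) hu (by rw [mulVec_transpose]; exact h2)
    refine ⟨hx, hu0, hw0, _, hval x hx u _ hu0 h2, ?_, h2⟩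
    rwa [← perron_value_eq hu0 hw0 h2 h1]
  have hex : ∀ x ∈ Set.Icc x₀ 1, ∃ w u, (x, w, u) ∈ E := by
    intro x hx
    obtain ⟨w, hw, r, hr⟩ := exists_perron (hB0 x) (hn x hx)
    obtain ⟨u, hu, t, ht⟩ := exists_perron (A := (symbolMatrix p a x)ᵀ)
      (fun i j => hB0 x j i) (hnT x hx)
    rw [mulVec_transpose] at ht
    refine ⟨w, u, ⟨hx, hw, hu⟩, ?_, ?_⟩
    · simp only [hr, Pi.smul_apply, smul_eq_mul, ← Finset.mul_sum, hw.2, mul_one]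
    · simp only [ht, Pi.smul_apply, smul_eq_mul, ← Finset.mul_sum, hu.2, mul_one]
  set l : ℝ × (ι → ℝ) × (ι → ℝ) → ℝ := fun q => flowDrift a (gibbsFlow p a q.1 q.2.2 q.2.1)
    with hl
  have hlc : Continuous l := by
    simp only [hl, flowDrift, gibbsFlow]
    refine continuous_finsetSum _ fun i _ => continuous_finsetSum _ fun j _ =>
      continuous_finsetSum _ fun s _ => ?_
    have := (Real.continuous_const_rpow (ha s).ne').comp
      (continuous_fst (X := ℝ) (Y := (ι → ℝ) × (ι → ℝ)))
    simp only [Function.comp_def] at this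
    fun_prop
  -- Projections of compact sets: two closed sets covering the interval. Connectedness then yields
  -- an exponent of zero drift without continuity of the Perron vectors in `x`.
  set P : Set ℝ := Prod.fst '' (E ∩ {q | 0 ≤ l q})
  set Q : Set ℝ := Prod.fst '' (E ∩ {q | l q ≤ 0})
  have hPc : IsClosed P :=
    ((hEc.inter_right (isClosed_le continuous_const hlc)).image continuous_fst).isClosed
  have hQc : IsClosed Q :=
    ((hEc.inter_right (isClosed_le hlc continuous_const)).image continuous_fst).isClosed
  have hcov : Set.Icc x₀ 1 ⊆ P ∪ Q := by
    intro x hx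
    obtain ⟨w, u, h⟩ := hex x hx
    rcases le_total 0 (l (x, w, u)) with h0 | h0
    · exact Or.inl ⟨_, ⟨h, h0⟩, rfl⟩
    · exact Or.inr ⟨_, ⟨h, h0⟩, rfl⟩
  have hm0 : x₀ ∈ Set.Icc x₀ 1 := ⟨le_rfl, hx₁⟩
  have hm1 : (1 : ℝ) ∈ Set.Icc x₀ 1 := ⟨hx₁, le_rfl⟩
  by_cases hP0 : x₀ ∈ P
  · obtain ⟨⟨x, w, u⟩, ⟨h, h0⟩, rfl⟩ := hP0
    obtain ⟨-, hu0, hw0, r, hr, hw, hu⟩ := hfull _ _ _ h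
    exact ⟨_, gibbsFlow_good ha haκ hp hr₀ hr hx₀ hκ hu0 hw0 hw hu (Or.inl ⟨h0, rfl⟩)⟩
  by_cases hQ1 : (1 : ℝ) ∈ Q
  · obtain ⟨⟨x, w, u⟩, ⟨h, h0⟩, hx⟩ := hQ1
    obtain ⟨-, hu0, hw0, r, hr, hw, hu⟩ := hfull _ _ _ h
    exact ⟨_, gibbsFlow_good ha haκ hp hr₀ hr hx₀ hκ hu0 hw0 hw hu (Or.inr (Or.inl ⟨h0, hx⟩))⟩
  obtain ⟨x, hx, hxP, hxQ⟩ := isPreconnected_closed_iff.1 isPreconnected_Icc P Q hPc hQc hcov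
    ⟨1, hm1, (hcov hm1).resolve_right hQ1⟩ ⟨x₀, hm0, (hcov hm0).resolve_left hP0⟩
  obtain ⟨⟨x, w, u⟩, ⟨h, h0⟩, rfl⟩ := hxP
  obtain ⟨⟨x', w', u'⟩, ⟨h', h0'⟩, hxx⟩ := hxQ
  obtain rfl : x' = x := hxx
  obtain ⟨-, hu0, hw0, r, hr, hw, hu⟩ := hfull _ _ _ h
  obtain ⟨-, hu0', hw0', r', hr', hw', hu'⟩ := hfull _ _ _ h'
  -- Uniqueness of the Perron vectors identifies the two triples over `x`, so the same drift is both
  -- non-negative and non-positive.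
  obtain rfl := perron_value_eq hu0 hw0' hu hw'
  obtain rfl : w = w' := perron_unique (hn _ hx) h.1.2.1 h'.1.2.1 hw hw'
  obtain rfl : u = u' := perron_unique (hnT _ hx) h.1.2.2 h'.1.2.2
    (by rw [mulVec_transpose]; exact hu) (by rw [mulVec_transpose]; exact hu')
  exact ⟨_, gibbsFlow_good ha haκ hp hr₀ hr hx₀ hκ hu0 hw0 hw hu
    (Or.inr (Or.inr (le_antisymm h0' h0)))⟩

end Gibbs

/-! ### Passage to integer flows -/

section Rational

open Filter Topology

variable {ι S : Type*} [Fintype ι] [Fintype S] {p τ : ι → ι → S → ℝ} {a : S → ℝ}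

lemma flowEntropy_smul {D : ℝ} (hD : 0 < D) :
    flowEntropy p (fun i j s => D * τ i j s) = D * flowEntropy p τ := by
  simp only [flowEntropy, Finset.mul_sum]
  refine Finset.sum_congr rfl fun i _ => Finset.sum_congr rfl fun j _ =>
    Finset.sum_congr rfl fun s _ => ?_
  simp only [← Finset.mul_sum]
  rw [mul_assoc D (∑ k, ∑ t, τ i k t), mul_div_mul_left _ _ hD.ne', mul_assoc]

lemma IsGoodFlow.smul (h : IsGoodFlow p a τ) {D : ℝ} (hD : 0 < D) :
    IsGoodFlow p a (fun i j s => D * τ i j s) := by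
  obtain ⟨h1, h2, h3, h4, h5⟩ := h
  have hL : flowDrift a (fun i j s => D * τ i j s) = D * flowDrift a τ := by
    simp only [flowDrift, Finset.mul_sum, mul_assoc]
  refine ⟨fun i j s => mul_nonneg hD.le (h1 i j s), fun i j s => ?_, fun i => ?_, ?_, ?_⟩
  · rw [mul_eq_zero, or_iff_right hD.ne', h2]
  · simp only [← Finset.mul_sum, h3 i]
  · rw [flowEntropy_smul hD]
    exact mul_pos hD h4
  · rw [flowEntropy_smul hD, hL, ← mul_add]
    exact mul_pos hD h5

/-- Terms with `p i j s = 0` vanish identically since `Real.log 0 = 0`; in the others `τ i j s > 0`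
by the support condition. -/
lemma continuousAt_flowEntropy (h : IsGoodFlow p a τ) (hp : ∀ i j s, 0 ≤ p i j s) :
    ContinuousAt (flowEntropy p) τ := by
  unfold flowEntropy
  refine tendsto_finsetSum _ fun i _ => tendsto_finsetSum _ fun j _ =>
    tendsto_finsetSum _ fun s _ => ?_
  rcases (hp i j s).eq_or_lt with h0 | h0
  · simp [← h0]
  have h1 : 0 < τ i j s := (h.1 i j s).lt_of_ne fun h' => h0.ne' ((h.2.1 i j s).1 h'.symm)
  have h2 : 0 < ∑ k, ∑ t, τ i k t := by
    refine h1.trans_le ?_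
    exact (Finset.single_le_sum (f := fun t => τ i j t) (fun t _ => h.1 i j t)
      (Finset.mem_univ s)).trans (Finset.single_le_sum (f := fun k => ∑ t, τ i k t)
      (fun k _ => Finset.sum_nonneg fun t _ => h.1 i k t) (Finset.mem_univ j))
  change ContinuousAt (fun τ : ι → ι → S → ℝ =>
    τ i j s * Real.log ((∑ k, ∑ t, τ i k t) * p i j s / τ i j s)) τ
  have hc : Continuous fun τ : ι → ι → S → ℝ => τ i j s := by fun_prop
  have hs : Continuous fun τ : ι → ι → S → ℝ => (∑ k, ∑ t, τ i k t) * p i j s := by fun_prop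
  exact hc.continuousAt.mul
    ((hs.continuousAt.div hc.continuousAt h1.ne').log (div_pos (mul_pos h2 h0) h1).ne')

/-- A good flow can be replaced by one with integer entries. -/
lemma IsGoodFlow.exists_nat (h : IsGoodFlow p a τ) (hp : ∀ i j s, 0 ≤ p i j s) :
    ∃ c : ι → ι → S → ℕ, IsGoodFlow p a (fun i j s => (c i j s : ℝ)) := by
  classical
  -- Expand the entries of `τ` in a `ℚ`-basis of their span and let the basis elements vary as real
  -- parameters `t`. Balance and vanishing entries are rational linear relations, so they hold for
  -- every `t`; the strict inequalities hold for `t` near the basis, in particular for some rational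
  -- `t`.
  set V : Submodule ℚ ℝ := Submodule.span ℚ (Set.range fun e : ι × ι × S => τ e.1 e.2.1 e.2.2)
    with hV
  have hfin : Module.Finite ℚ V := Module.Finite.span_of_finite ℚ (Set.finite_range _)
  set b := Module.finBasis ℚ V
  have hmem : ∀ i j s, τ i j s ∈ V := fun i j s => Submodule.subset_span ⟨(i, j, s), rfl⟩
  set v : ι → ι → S → V := fun i j s => ⟨τ i j s, hmem i j s⟩ with hv
  set m := Module.finrank ℚ V
  set Φ : (Fin m → ℝ) → ι → ι → S → ℝ :=
    fun t i j s => ∑ k, ((b.repr (v i j s) k : ℚ) : ℝ) * t k with hΦ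
  have hΦb : Φ (fun k => (b k : ℝ)) = τ := by
    funext i j s
    have := congrArg (Subtype.val) (b.sum_repr (v i j s))
    simp only [Submodule.coe_sum, Submodule.coe_smul, hv, Rat.smul_def] at this
    exact this
  have hΦc : Continuous Φ := by fun_prop
  have hzero : ∀ t i j s, τ i j s = 0 → Φ t i j s = 0 := by
    intro t i j s h0
    have : v i j s = 0 := Subtype.ext h0
    simp [hΦ, this]
  have hbal : ∀ t i, ∑ j, ∑ s, Φ t i j s = ∑ j, ∑ s, Φ t j i s := by
    intro t i
    have h1 : ∑ j, ∑ s, v i j s = ∑ j, ∑ s, v j i s := by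
      apply Subtype.ext
      simp only [Submodule.coe_sum, hv]
      exact h.2.2.1 i
    have h2 : ∀ k, ∑ j, ∑ s, b.repr (v i j s) k = ∑ j, ∑ s, b.repr (v j i s) k := fun k => by
      simpa using congrArg (fun z => b.repr z k) h1
    have h3 : ∀ w : ι → S → V, ∑ j, ∑ s, ∑ k, ((b.repr (w j s) k : ℚ) : ℝ) * t k =
        ∑ k, ((∑ j, ∑ s, b.repr (w j s) k : ℚ) : ℝ) * t k := by
      intro w
      push_cast
      simp only [Finset.sum_mul]
      rw [Finset.sum_congr rfl fun j _ => Finset.sum_comm, Finset.sum_comm]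
    simp only [hΦ]
    rw [h3, h3 (fun j s => v j i s)]
    simp only [h2]
  have hgood : ∀ᶠ t in 𝓝 (fun k => (b k : ℝ)), IsGoodFlow p a (Φ t) := by
    have hG : Tendsto (fun t => flowEntropy p (Φ t)) (𝓝 fun k => (b k : ℝ))
        (𝓝 (flowEntropy p τ)) := by
      have h1 := hΦc.tendsto (fun k => (b k : ℝ))
      rw [hΦb] at h1
      exact (continuousAt_flowEntropy h hp).tendsto.comp h1
    have hL : Tendsto (fun t => flowDrift a (Φ t)) (𝓝 fun k => (b k : ℝ))
        (𝓝 (flowDrift a τ)) := by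
      have h1 := hΦc.tendsto (fun k => (b k : ℝ))
      rw [hΦb] at h1
      have h2 : Continuous (flowDrift (ι := ι) a) := by
        unfold flowDrift
        fun_prop
      exact (h2.tendsto τ).comp h1
    have hpos : ∀ᶠ t in 𝓝 (fun k => (b k : ℝ)), ∀ i j s, 0 < τ i j s → 0 < Φ t i j s := by
      simp only [eventually_all]
      intro i j s h0
      have h1 : Continuous fun t => Φ t i j s := by fun_prop
      refine (h1.tendsto _).eventually (lt_mem_nhds ?_)
      rwa [hΦb]
    filter_upwards [hG.eventually (lt_mem_nhds h.2.2.2.1),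
      (hG.add hL).eventually (lt_mem_nhds h.2.2.2.2), hpos] with t h1 h2 h3
    have h4 : ∀ i j s, 0 ≤ Φ t i j s ∧ (Φ t i j s = 0 ↔ τ i j s = 0) := by
      intro i j s
      rcases (h.1 i j s).eq_or_lt with h0 | h0
      · exact ⟨(hzero t i j s h0.symm).ge, fun _ => h0.symm, hzero t i j s⟩
      · exact ⟨(h3 i j s h0).le, fun h' => absurd h' (h3 i j s h0).ne',
          fun h' => absurd h' h0.ne'⟩
    exact ⟨fun i j s => (h4 i j s).1, fun i j s => (h4 i j s).2.trans (h.2.1 i j s),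
      hbal t, h1, h2⟩
  have hdense : DenseRange (fun (q : Fin m → ℚ) (k : Fin m) => (q k : ℝ)) :=
    DenseRange.piMap fun _ => Rat.denseRange_cast
  obtain ⟨q, hq⟩ := hdense.exists_mem_open isOpen_interior
    ⟨_, mem_interior_iff_mem_nhds.2 hgood⟩
  replace hq : IsGoodFlow p a (Φ fun k => (q k : ℝ)) :=
    (interior_subset (s := {t | IsGoodFlow p a (Φ t)}) hq :)
  set y : ι → ι → S → ℚ := fun i j s => ∑ k, b.repr (v i j s) k * q k with hy
  have hΦy : (Φ fun k => (q k : ℝ)) = fun i j s => (y i j s : ℝ) := by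
    funext i j s
    simp [hΦ, hy]
  rw [hΦy] at hq
  set D : ℕ := ∏ e : ι × ι × S, (y e.1 e.2.1 e.2.2).den with hD
  have hDpos : 0 < D := Finset.prod_pos fun e _ => Rat.den_pos _
  have hint : ∀ i j s, ∃ n : ℕ, (n : ℝ) = D * (y i j s : ℝ) := by
    intro i j s
    obtain ⟨k, hk⟩ : (y i j s).den ∣ D :=
      Finset.dvd_prod_of_mem (fun e : ι × ι × S => (y e.1 e.2.1 e.2.2).den)
        (Finset.mem_univ (i, j, s))
    have hnum : 0 ≤ (y i j s).num := Rat.num_nonneg.2 (Rat.cast_nonneg.1 (hq.1 i j s))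
    refine ⟨k * (y i j s).num.toNat, ?_⟩
    have h1 : ((y i j s).num.toNat : ℝ) = (((y i j s).num : ℤ) : ℝ) := by
      exact_mod_cast congrArg (Int.cast (R := ℝ)) (Int.toNat_of_nonneg hnum)
    have h2 : ((y i j s).den : ℝ) * (y i j s : ℝ) = ((y i j s).num : ℝ) := by
      exact_mod_cast congrArg (Rat.cast (K := ℝ)) (Rat.den_mul_eq_num (y i j s))
    rw [hk]
    push_cast
    rw [h1, ← h2]
    ring
  choose c hc using hint
  refine ⟨c, ?_⟩
  simp only [hc]
  exact hq.smul (by exact_mod_cast hDpos)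

end Rational

/-! ### Discretization of the entries, uniformly in the exponent -/

section Discretization

open Filter Topology

lemma rpow_le_one_add {t x : ℝ} (ht : 0 ≤ t) (hx : x ∈ Set.Ioc (0 : ℝ) 1) : t ^ x ≤ 1 + t := by
  rcases le_total t 1 with h | h
  · linarith [Real.rpow_le_one ht h hx.1.le]
  · have := Real.rpow_le_rpow_of_exponent_le h hx.2
    rw [Real.rpow_one] at this
    linarith

lemma min_one_le_rpow {t x : ℝ} (ht : 0 ≤ t) (hx : x ∈ Set.Ioc (0 : ℝ) 1) : min 1 t ≤ t ^ x := by
  rcases le_total t 1 with h | h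
  · rw [min_eq_right h]
    rcases ht.eq_or_lt with rfl | h0
    · exact Real.rpow_nonneg le_rfl x
    · simpa using Real.rpow_le_rpow_of_exponent_ge h0 h hx.2
  · rw [min_eq_left h]
    exact Real.one_le_rpow h hx.1.le

/-- The cells of the geometric grid of ratio `exp δ`. -/
noncomputable def cell (δ : ℝ) (l : ℤ) : Set ℝ :=
  Set.Ico (Real.exp (δ * l)) (Real.exp (δ * (l + 1)))

lemma measurableSet_cell (δ : ℝ) (l : ℤ) : MeasurableSet (cell δ l) := measurableSet_Ico

lemma mem_cell_iff {δ : ℝ} (hδ : 0 < δ) {l : ℤ} {t : ℝ} (ht : 0 < t) :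
    t ∈ cell δ l ↔ ⌊Real.log t / δ⌋ = l := by
  rw [cell, Set.mem_Ico, Int.floor_eq_iff, ← Real.le_log_iff_exp_le ht, ← Real.log_lt_iff_lt_exp ht,
    le_div_iff₀ hδ, div_lt_iff₀ hδ, mul_comm, mul_comm δ]

lemma cell_disjoint {δ : ℝ} (hδ : 0 < δ) {l l' : ℤ} (h : l ≠ l') :
    Disjoint (cell δ l) (cell δ l') := by
  rw [Set.disjoint_left]
  intro t h1 h2
  have ht : 0 < t := (Real.exp_pos _).trans_le h1.1
  exact h (((mem_cell_iff hδ ht).1 h1).symm.trans ((mem_cell_iff hδ ht).1 h2))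

/-- The positive reals outside the cells of indices in `[-m, m)`. -/
def offGrid (δ : ℝ) (m : ℕ) : Set ℝ :=
  Set.Ioi 0 \ Set.Ico (Real.exp (-(δ * m))) (Real.exp (δ * m))

/-- Replacing `t` by the left end of its cell costs a factor at most `exp (δ x) ≤ exp δ`. Off the
grid, `1 + t` dominates all the powers at once, which makes the truncation uniform in `x`. Zero lies
in no cell, hence the restriction to `x > 0`, where `0 ^ x = 0`. -/
lemma rpow_le_grid {δ : ℝ} (hδ : 0 < δ) (m : ℕ) {t x : ℝ} (ht : 0 ≤ t)
    (hx : x ∈ Set.Ioc (0 : ℝ) 1) :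
    t ^ x ≤ Real.exp δ * ∑ l ∈ Finset.Ico (-m : ℤ) m,
      (cell δ l).indicator (fun _ => Real.exp (δ * l) ^ x) t +
      (offGrid δ m).indicator (fun t => 1 + t) t := by
  have hS : ∀ l ∈ Finset.Ico (-m : ℤ) m,
      0 ≤ (cell δ l).indicator (fun _ => Real.exp (δ * l) ^ x) t := fun l _ =>
    Set.indicator_nonneg (fun _ _ => Real.rpow_nonneg (Real.exp_pos _).le x) t
  rcases ht.eq_or_lt with rfl | h0
  · rw [Real.zero_rpow hx.1.ne']
    exact add_nonneg (mul_nonneg (Real.exp_pos _).le (Finset.sum_nonneg hS))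
      (Set.indicator_nonneg (fun t ht => by linarith [Set.mem_Ioi.1 ht.1]) _)
  by_cases hb : t ∈ offGrid δ m
  · rw [Set.indicator_of_mem hb]
    have := mul_nonneg (Real.exp_pos δ).le (Finset.sum_nonneg hS)
    linarith [rpow_le_one_add ht hx]
  rw [Set.indicator_of_notMem hb, add_zero]
  have hI : t ∈ Set.Ico (Real.exp (-(δ * m))) (Real.exp (δ * m)) := by
    by_contra h
    exact hb ⟨h0, h⟩
  set l := ⌊Real.log t / δ⌋ with hl
  have hcell : t ∈ cell δ l := (mem_cell_iff hδ h0).2 rfl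
  have hlm : l ∈ Finset.Ico (-m : ℤ) m := by
    rw [Finset.mem_Ico, hl, Int.le_floor, Int.floor_lt, le_div_iff₀ hδ, div_lt_iff₀ hδ,
      Real.le_log_iff_exp_le h0, Real.log_lt_iff_lt_exp h0]
    push_cast
    rw [neg_mul, mul_comm _ δ]
    exact hI
  calc t ^ x ≤ Real.exp (δ * (l + 1)) ^ x := Real.rpow_le_rpow ht hcell.2.le hx.1.le
    _ = Real.exp (δ * x) * Real.exp (δ * l) ^ x := by
        rw [← Real.exp_mul, ← Real.exp_mul, ← Real.exp_add]
        ring_nf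
    _ ≤ Real.exp δ * Real.exp (δ * l) ^ x := by
        refine mul_le_mul_of_nonneg_right (Real.exp_le_exp.2 ?_)
          (Real.rpow_nonneg (Real.exp_pos _).le x)
        exact mul_le_of_le_one_right hδ.le hx.2
    _ = Real.exp δ * (cell δ l).indicator (fun _ => Real.exp (δ * l) ^ x) t := by
        rw [Set.indicator_of_mem hcell]
    _ ≤ _ := mul_le_mul_of_nonneg_left (Finset.single_le_sum hS hlm) (Real.exp_pos _).le

lemma tendsto_setIntegral_offGrid {μ : Measure ℝ} [IsFiniteMeasure μ] (hint : Integrable id μ)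
    {δ : ℝ} (hδ : 0 < δ) :
    Tendsto (fun m : ℕ => ∫ t in offGrid δ m, (1 + t) ∂μ) atTop (𝓝 0) := by
  have hm : ∀ m, MeasurableSet (offGrid δ m) := fun m => measurableSet_Ioi.diff measurableSet_Ico
  have hanti : Antitone (offGrid δ) := by
    intro m n hmn
    refine Set.sdiff_subset_sdiff_right (Set.Ico_subset_Ico ?_ ?_)
    · gcongr
    · gcongr
  have hempty : ⋂ m, offGrid δ m = ∅ := by
    rw [Set.eq_empty_iff_forall_notMem]
    intro t ht
    rw [Set.mem_iInter] at ht
    have h0 : 0 < t := (ht 0).1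
    obtain ⟨m, hm⟩ := exists_nat_gt (|Real.log t| / δ)
    rw [div_lt_iff₀ hδ, mul_comm, abs_lt] at hm
    exact (ht m).2 ⟨(Real.le_log_iff_exp_le h0).1 hm.1.le, (Real.log_lt_iff_lt_exp h0).1 hm.2⟩
  have h1 : Integrable (fun t : ℝ => 1 + t) μ := (integrable_const 1).add hint
  have := tendsto_setIntegral_of_antitone (f := fun t : ℝ => 1 + t) hm hanti ⟨0, h1.integrableOn⟩
  simpa [hempty] using this

lemma integrable_rpow_id {μ : Measure ℝ} [IsFiniteMeasure μ] (h0 : ∀ᵐ t ∂μ, 0 ≤ t)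
    (hint : Integrable id μ) {x : ℝ} (hx : x ∈ Set.Ioc (0 : ℝ) 1) :
    Integrable (fun t : ℝ => t ^ x) μ := by
  refine Integrable.mono' ((integrable_const 1).add hint)
    (measurable_id.pow_const x).aestronglyMeasurable ?_
  filter_upwards [h0] with t ht
  rw [Real.norm_of_nonneg (Real.rpow_nonneg ht x)]
  exact rpow_le_one_add ht hx

lemma integral_rpow_le_grid {μ : Measure ℝ} [IsProbabilityMeasure μ] (h0 : ∀ᵐ t ∂μ, 0 ≤ t)
    (hint : Integrable id μ) {δ : ℝ} (hδ : 0 < δ) (m : ℕ) {x : ℝ} (hx : x ∈ Set.Ioc (0 : ℝ) 1) :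
    ∫ t, t ^ x ∂μ ≤ Real.exp δ * ∑ l ∈ Finset.Ico (-m : ℤ) m,
      μ.real (cell δ l) * Real.exp (δ * l) ^ x + ∫ t in offGrid δ m, (1 + t) ∂μ := by
  have hm : MeasurableSet (offGrid δ m) := measurableSet_Ioi.diff measurableSet_Ico
  have h1 : Integrable (fun t : ℝ => 1 + t) μ := (integrable_const 1).add hint
  have hc : ∀ l ∈ Finset.Ico (-m : ℤ) m,
      Integrable ((cell δ l).indicator (fun _ => Real.exp (δ * l) ^ x)) μ := fun l _ =>
    (integrable_const _).indicator (measurableSet_cell δ l)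
  have hs := (integrable_finsetSum _ hc).const_mul (Real.exp δ)
  have := integral_mono_ae (integrable_rpow_id h0 hint hx) (hs.add (h1.indicator hm))
    (by
      filter_upwards [h0] with t ht
      simpa using rpow_le_grid hδ m ht hx)
  refine this.trans_eq ?_
  simp only [Pi.add_apply]
  rw [integral_add hs (h1.indicator hm), integral_const_mul, integral_finsetSum _ hc,
    integral_indicator hm]
  simp [integral_indicator, measurableSet_cell]

/-- A finite part of a fine enough geometric grid captures the moments of order `x ∈ (0, 1]` up to
a factor close to one, uniformly in `x`. -/
lemma exists_grid {E : Type*} [Finite E] (μ : E → Measure ℝ) [∀ e, IsProbabilityMeasure (μ e)]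
    (h0 : ∀ e, ∀ᵐ t ∂μ e, 0 ≤ t) (hint : ∀ e, Integrable id (μ e)) {ε : ℝ} (hε : 0 < ε)
    (hε2 : ε < 1) :
    ∃ δ : ℝ, 0 < δ ∧ ∃ m : ℕ, ∀ e, ∀ x ∈ Set.Ioc (0 : ℝ) 1,
      (1 - ε) * ∫ t, t ^ x ∂μ e ≤
        ∑ l ∈ Finset.Ico (-m : ℤ) m, (μ e).real (cell δ l) * Real.exp (δ * l) ^ x := by
  -- One factor `1 - δ` pays for the values off the grid, another for the ratio `exp δ`, and `(1 -
  -- δ) ^ 2 ≥ 1 - 2 * δ = 1 - ε`.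
  set δ := ε / 2 with hδ
  have hδ0 : 0 < δ := by positivity
  refine ⟨δ, hδ0, ?_⟩
  suffices h : ∀ e, ∀ᶠ m : ℕ in atTop, ∀ x ∈ Set.Ioc (0 : ℝ) 1,
      (1 - ε) * ∫ t, t ^ x ∂μ e ≤
        ∑ l ∈ Finset.Ico (-m : ℤ) m, (μ e).real (cell δ l) * Real.exp (δ * l) ^ x from
    (eventually_all.2 h).exists
  intro e
  have hmin : Integrable (fun t : ℝ => min 1 t) (μ e) := by
    refine Integrable.mono' (hint e) (by fun_prop) ?_
    filter_upwards [h0 e] with t ht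
    rw [Real.norm_of_nonneg (le_min zero_le_one ht)]
    exact min_le_right _ _
  have hmin0 : 0 ≤ᵐ[μ e] fun t : ℝ => min 1 t := by
    filter_upwards [h0 e] with t ht using le_min zero_le_one ht
  have hSnn : ∀ (m : ℕ) (x : ℝ),
      0 ≤ ∑ l ∈ Finset.Ico (-m : ℤ) m, (μ e).real (cell δ l) * Real.exp (δ * l) ^ x :=
    fun m x => Finset.sum_nonneg fun l _ =>
      mul_nonneg measureReal_nonneg (Real.rpow_nonneg (Real.exp_pos _).le x)
  rcases (integral_nonneg_of_ae hmin0).eq_or_lt with hc | hc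
  · have hz : ∀ᵐ t ∂μ e, t = 0 := by
      filter_upwards [(integral_eq_zero_iff_of_nonneg_ae hmin0 hmin).1 hc.symm] with t ht
      rcases min_choice (1 : ℝ) t with h | h
      · simp [h] at ht
      · simpa [h] using ht
    refine Eventually.of_forall fun m x hx => ?_
    have : ∫ t, t ^ x ∂μ e = 0 := by
      refine integral_eq_zero_of_ae ?_
      filter_upwards [hz] with t ht
      simp [ht, Real.zero_rpow hx.1.ne']
    rw [this, mul_zero]
    exact hSnn m x
  -- All the moments are at least the integral of `min 1 t`, so an off-grid error below `δ` times
  -- this integral is negligible for every `x` simultaneously.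
  · filter_upwards [(tendsto_setIntegral_offGrid (hint e) hδ0).eventually
      (gt_mem_nhds (mul_pos hδ0 hc))] with m hm x hx
    have h1 := integral_rpow_le_grid (h0 e) (hint e) hδ0 m hx
    have h2 : ∫ t, min 1 t ∂μ e ≤ ∫ t, t ^ x ∂μ e := by
      refine integral_mono_ae hmin (integrable_rpow_id (h0 e) (hint e) hx) ?_
      filter_upwards [h0 e] with t ht using min_one_le_rpow ht hx
    set A := ∫ t, t ^ x ∂μ e
    set B := ∑ l ∈ Finset.Ico (-m : ℤ) m, (μ e).real (cell δ l) * Real.exp (δ * l) ^ x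
    have h3 : (1 - δ) * A ≤ Real.exp δ * B := by nlinarith
    have h4 : (1 - δ) * Real.exp δ ≤ 1 := by
      have := mul_le_mul_of_nonneg_right (Real.one_sub_le_exp_neg δ) (Real.exp_pos δ).le
      rwa [← Real.exp_add, neg_add_cancel, Real.exp_zero] at this
    have hA : 0 ≤ A := hc.le.trans h2
    have hδ1 : 0 ≤ 1 - δ := by linarith
    calc (1 - ε) * A ≤ (1 - δ) * ((1 - δ) * A) := by
          have h5 : ε = 2 * δ := by rw [hδ]; ring
          rw [h5]
          nlinarith [mul_nonneg (sq_nonneg δ) hA]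
      _ ≤ (1 - δ) * (Real.exp δ * B) := mul_le_mul_of_nonneg_left h3 hδ1
      _ = ((1 - δ) * Real.exp δ) * B := by ring
      _ ≤ B := mul_le_of_le_one_left (hSnn m x) h4

end Discretization

/-! ### Closed walks with prescribed step counts, and the subtree -/

section Walks

variable {d : ℕ}

lemma colour_append (α : Fin d) (u l : Vertex d) :
    colour α (u ++ l) = colour (colour α u) l := by
  rcases List.eq_nil_or_concat l with rfl | ⟨l, b, rfl⟩
  · simp [colour]
  · simp [colour, ← List.append_assoc]

lemma colour_eq_or_mem (α : Fin d) (u : Vertex d) : colour α u = α ∨ colour α u ∈ u := by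
  rcases List.eq_nil_or_concat u with rfl | ⟨l, b, rfl⟩
  · simp [colour]
  · simp [colour]

/-- The numbers of steps of each type of the walk through the letters of a word, started in `a`. -/
def stepCount : Fin d → Vertex d → Matrix (Fin d) (Fin d) ℕ
  | _, [] => 0
  | a, b :: l => Matrix.single a b 1 + stepCount b l

lemma stepCount_append (a : Fin d) (l l' : Vertex d) :
    stepCount a (l ++ l') = stepCount a l + stepCount (colour a l) l' := by
  induction l generalizing a with
  | nil => simp [stepCount, colour]
  | cons b l ih =>
    have : colour a (b :: l) = colour b l := colour_append a [b] l
    rw [this, List.cons_append, stepCount, stepCount, ih, add_assoc]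

lemma edgeCount_eq_sum (α : Fin d) {u v w : Vertex d} (hv : v <+: w)
    (i j : Fin d) :
    edgeCount α u v i j = ∑ k ∈ Finset.Ico u.length v.length,
      if colour α (w.take k) = i ∧ colour α (w.take (k + 1)) = j then 1 else 0 := by
  rw [edgeCount, Finset.card_filter]
  refine Finset.sum_congr rfl fun k hk => ?_
  rw [Finset.mem_Ico] at hk
  have h : ∀ m ≤ v.length, v.take m = w.take m := by
    intro m hm
    conv_lhs => rw [List.prefix_iff_eq_take.1 hv]
    rw [List.take_take, min_eq_left hm]
  rw [h k (by lia), h (k + 1) (by lia)]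

lemma edgeCount_append (α : Fin d) (u l : Vertex d) (i j : Fin d) :
    edgeCount α u (u ++ l) i j = stepCount (colour α u) l i j := by
  induction l generalizing u with
  | nil => simp [edgeCount, stepCount]
  | cons b l ih =>
    have h := ih (u ++ [b])
    have hw : u ++ b :: l = u ++ [b] ++ l := by simp
    rw [edgeCount_eq_sum α (w := u ++ b :: l) (by rw [hw])] at h
    rw [edgeCount_eq_sum α (List.prefix_refl _),
      Finset.sum_eq_sum_Ico_succ_bot (by simp)]
    have h2 : colour α (u ++ [b]) = b := by simp [colour]
    have h1 : (u ++ b :: l).take (u.length + 1) = u ++ [b] := by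
      rw [hw, List.take_left' (by simp)]
    rw [h1, List.take_left, h2, stepCount, Matrix.add_apply, ← h2, ← h, h2]
    congr 1
    simp

/-- Every arrival at `i` is followed by a departure, except at the end of the walk; every departure
follows an arrival, except at the start. -/
lemma stepCount_balance (a i : Fin d) (l : Vertex d) :
    ∑ j, stepCount a l i j + (if colour a l = i then 1 else 0) =
      ∑ j, stepCount a l j i + (if a = i then 1 else 0) := by
  induction l generalizing a with
  | nil => simp [stepCount, colour]
  | cons b l ih =>
    have hc : colour a (b :: l) = colour b l := colour_append a [b] l
    have h := ih b
    have h1 : ∑ j, Matrix.single a b (1 : ℕ) i j = if a = i then 1 else 0 := by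
      simp [Matrix.single_apply, ite_and]
    have h2 : ∑ j, Matrix.single a b (1 : ℕ) j i = if b = i then 1 else 0 := by
      simp [Matrix.single_apply, ite_and]
    simp only [hc, stepCount, Matrix.add_apply, Finset.sum_add_distrib, h1, h2]
    lia

lemma stepCount_sum (a : Fin d) (l : Vertex d) : ∑ i, ∑ j, stepCount a l i j = l.length := by
  induction l generalizing a with
  | nil => simp [stepCount]
  | cons b l ih =>
    have h1 : ∑ i, ∑ j, Matrix.single a b (1 : ℕ) i j = 1 := by
      simp [Matrix.single_apply, ite_and]
    simp only [stepCount, Matrix.add_apply, Finset.sum_add_distrib, ih, h1, List.length_cons]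
    lia

lemma apply_le_total (μ : Matrix (Fin d) (Fin d) ℕ) (i j : Fin d) : μ i j ≤ ∑ i, ∑ j, μ i j :=
  (Finset.single_le_sum (f := fun j => μ i j) (fun _ _ => Nat.zero_le _)
    (Finset.mem_univ j)).trans (Finset.single_le_sum (f := fun i => ∑ j, μ i j)
    (fun _ _ => Nat.zero_le _) (Finset.mem_univ i))

/-- Extend the walk greedily, `n` bounding the number of unused steps. A walk that has not closed
has arrived at its end colour once more than it has left it, so balance of `μ` leaves an unused
departure; once `μ` is exhausted, balance forces closure. -/
lemma exists_closed_walk_of_walk {μ : Matrix (Fin d) (Fin d) ℕ}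
    (hμ : ∀ i, ∑ j, μ i j = ∑ j, μ j i) {a : Fin d} (n : ℕ) (l : Vertex d) (hl : l ≠ [])
    (hle : ∀ i j, stepCount a l i j ≤ μ i j) (hn : ∑ i, ∑ j, μ i j ≤ l.length + n) :
    ∃ l : Vertex d, l ≠ [] ∧ colour a l = a ∧ ∀ i j, stepCount a l i j ≤ μ i j := by
  induction n generalizing l with
  | zero =>
    refine ⟨l, hl, ?_, hle⟩
    by_contra hne
    have hb := stepCount_balance a (colour a l) l
    rw [if_pos rfl, if_neg (fun h => hne h.symm)] at hb
    have h1 : ∀ i j, stepCount a l i j = μ i j := by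
      by_contra! h
      obtain ⟨i, j, hij⟩ := h
      have : ∑ i, ∑ j, stepCount a l i j < ∑ i, ∑ j, μ i j :=
        Finset.sum_lt_sum (fun i _ => Finset.sum_le_sum fun j _ => hle i j)
          ⟨i, Finset.mem_univ i, Finset.sum_lt_sum (fun j _ => hle i j)
            ⟨j, Finset.mem_univ j, lt_of_le_of_ne (hle i j) hij⟩⟩
      rw [stepCount_sum] at this
      lia
    simp only [h1, hμ (colour a l)] at hb
    lia
  | succ n ih =>
    by_cases hc : colour a l = a
    · exact ⟨l, hl, hc, hle⟩
    have hb := stepCount_balance a (colour a l) l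
    rw [if_pos rfl, if_neg (fun h => hc h.symm)] at hb
    have h1 : ∑ j, stepCount a l j (colour a l) ≤ ∑ j, μ j (colour a l) :=
      Finset.sum_le_sum fun j _ => hle j _
    rw [← hμ] at h1
    obtain ⟨b, -, hb⟩ := Finset.exists_lt_of_sum_lt
      (show ∑ j, stepCount a l (colour a l) j < ∑ j, μ (colour a l) j by lia)
    refine ih (l ++ [b]) (by simp) (fun i j => ?_) (by simp; lia)
    rw [stepCount_append]
    simp only [stepCount, add_zero, Matrix.add_apply, Matrix.single_apply]
    split_ifs with h
    · rw [← h.1, ← h.2]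
      exact hb
    · exact hle i j

lemma exists_closed_walk {μ : Matrix (Fin d) (Fin d) ℕ}
    (hμ : ∀ i, ∑ j, μ i j = ∑ j, μ j i) {a b : Fin d} (hab : 0 < μ a b) :
    ∃ l : Vertex d, l ≠ [] ∧ colour a l = a ∧ ∀ i j, stepCount a l i j ≤ μ i j := by
  refine exists_closed_walk_of_walk hμ (∑ i, ∑ j, μ i j) [b] (by simp) (fun i j => ?_) (by simp)
  simp only [stepCount, add_zero, Matrix.single_apply]
  split_ifs with h
  · rw [← h.1, ← h.2]
    exact hab
  · exact Nat.zero_le _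

/-- Any balanced matrix can be added to the step counts of a closed walk through all letters. -/
lemma exists_closed_walk_add {a : Fin d} (n : ℕ) (μ : Matrix (Fin d) (Fin d) ℕ)
    (hμ : ∀ i, ∑ j, μ i j = ∑ j, μ j i) (hn : ∑ i, ∑ j, μ i j = n) (W : Vertex d)
    (hW : colour a W = a) (hspan : ∀ c, c = a ∨ c ∈ W) :
    ∃ W' : Vertex d, colour a W' = a ∧ stepCount a W' = stepCount a W + μ := by
  induction n using Nat.strong_induction_on generalizing μ W with
  | _ n ih =>
    by_cases h0 : μ = 0
    · exact ⟨W, hW, by simp [h0]⟩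
    obtain ⟨c, b, hcb⟩ : ∃ c b, 0 < μ c b := by
      by_contra! h
      exact h0 (Matrix.ext fun i j => Nat.le_zero.1 (h i j))
    -- Hierholzer's argument: peel a closed walk `l` through `c` off `μ`, splice it into `W` at a
    -- visit to `c`, and recurse on what is left of `μ`.
    obtain ⟨l, hl, hlc, hle⟩ := exists_closed_walk hμ hcb
    obtain ⟨l₁, l₂, rfl, hc⟩ : ∃ l₁ l₂, W = l₁ ++ l₂ ∧ colour a l₁ = c := by
      rcases hspan c with rfl | h
      · exact ⟨[], W, rfl, rfl⟩
      · obtain ⟨s, t, rfl⟩ := List.append_of_mem h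
        exact ⟨s ++ [c], t, by simp, by simp [colour]⟩
    have hsplit : μ = (μ - stepCount c l) + stepCount c l :=
      Matrix.ext fun i j => (Nat.sub_add_cancel (hle i j)).symm
    have hbal : ∀ i, ∑ j, (μ - stepCount c l) i j = ∑ j, (μ - stepCount c l) j i := by
      intro i
      have h1 := hμ i
      rw [hsplit] at h1
      simp only [Matrix.add_apply, Finset.sum_add_distrib] at h1
      have h2 := stepCount_balance c i l
      rw [hlc] at h2
      lia
    have hlt : ∑ i, ∑ j, (μ - stepCount c l) i j < n := by
      have h1 := hn
      rw [hsplit] at h1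
      simp only [Matrix.add_apply, Finset.sum_add_distrib, stepCount_sum] at h1
      have := List.length_pos_iff.2 hl
      lia
    rw [colour_append, hc] at hW
    obtain ⟨W', h1, h2⟩ := ih _ hlt _ hbal rfl (l₁ ++ l ++ l₂)
      (by rw [colour_append, colour_append, hc, hlc, hW])
      (fun c => (hspan c).imp_right fun h => by
        simp only [List.mem_append] at h ⊢
        tauto)
    refine ⟨W', h1, ?_⟩
    rw [h2, stepCount_append, stepCount_append, stepCount_append, colour_append, hc, hlc]
    conv_rhs => rw [hsplit]
    generalize μ - stepCount c l = X
    abel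

lemma exists_spanning_walk {R : Fin d → Fin d → Prop}
    (hR : ∀ a b, ∃ l : Vertex d, colour a l = b ∧ ∀ i j, ¬ R i j → stepCount a l i j = 0)
    (a : Fin d) : ∃ W : Vertex d, colour a W = a ∧ (∀ c, c = a ∨ c ∈ W) ∧
      ∀ i j, ¬ R i j → stepCount a W i j = 0 := by
  have key : ∀ cs : List (Fin d), ∃ W : Vertex d, (∀ c ∈ cs, c = a ∨ c ∈ W) ∧
      ∀ i j, ¬ R i j → stepCount a W i j = 0 := by
    intro cs
    induction cs with
    | nil => exact ⟨[], by simp, by simp [stepCount]⟩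
    | cons c cs ih =>
      obtain ⟨W, h1, h2⟩ := ih
      obtain ⟨l, h3, h4⟩ := hR (colour a W) c
      refine ⟨W ++ l, ?_, fun i j h => by simp [stepCount_append, h2 i j h, h4 i j h]⟩
      rw [List.forall_mem_cons]
      refine ⟨?_, fun c hc => (h1 c hc).imp_right fun h => List.mem_append_left l h⟩
      rw [← h3, ← colour_append]
      exact colour_eq_or_mem a (W ++ l)
  obtain ⟨W, h1, h2⟩ := key (List.finRange d)
  obtain ⟨l, h3, h4⟩ := hR (colour a W) a
  exact ⟨W ++ l, by rw [colour_append, h3], fun c => (h1 c (List.mem_finRange c)).imp_right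
    fun h => List.mem_append_left l h, fun i j h => by
      simp [stepCount_append, h2 i j h, h4 i j h]⟩

/-- Large multiples of a balanced, strongly connected matrix of natural numbers are the step counts
of closed walks from any letter. -/
lemma exists_eulerian_walk {ν : Matrix (Fin d) (Fin d) ℕ} (hν : ∀ i, ∑ j, ν i j = ∑ j, ν j i)
    (hR : ∀ a b, ∃ l : Vertex d, colour a l = b ∧ ∀ i j, ν i j = 0 → stepCount a l i j = 0) :
    ∃ q : ℕ, 1 ≤ q ∧ ∀ a, ∃ W : Vertex d, colour a W = a ∧ stepCount a W = q • ν := by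
  have h := exists_spanning_walk (R := fun i j => ν i j ≠ 0) (by simpa using hR)
  choose W h1 h2 h3 using h
  -- Large enough for `q • ν` to dominate the step counts of every spanning walk `W a`. The
  -- difference is balanced and can be spliced in.
  set q := 1 + ∑ a, (W a).length
  refine ⟨q, by lia, fun a => ?_⟩
  have hle : ∀ i j, stepCount a (W a) i j ≤ (q • ν) i j := by
    intro i j
    by_cases h0 : ν i j = 0
    · rw [h3 a i j (by simpa using h0)]
      exact Nat.zero_le _
    · calc stepCount a (W a) i j ≤ (W a).length :=
            (apply_le_total _ i j).trans_eq (stepCount_sum a (W a))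
        _ ≤ ∑ a, (W a).length :=
            Finset.single_le_sum (f := fun a => (W a).length) (fun _ _ => Nat.zero_le _)
              (Finset.mem_univ a)
        _ ≤ q * 1 := by lia
        _ ≤ q * ν i j := Nat.mul_le_mul_left q (Nat.one_le_iff_ne_zero.2 h0)
  have hbal : ∀ i, ∑ j, (q • ν - stepCount a (W a)) i j =
      ∑ j, (q • ν - stepCount a (W a)) j i := by
    intro i
    have h4 := stepCount_balance a i (W a)
    rw [h1] at h4
    have h5 : ∑ j, (q • ν) i j = ∑ j, (q • ν) j i := by
      simp [← Finset.mul_sum, hν i]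
    have h6 : ∑ j, (q • ν - stepCount a (W a)) i j + ∑ j, stepCount a (W a) i j =
        ∑ j, (q • ν) i j := by
      rw [← Finset.sum_add_distrib]
      exact Finset.sum_congr rfl fun j _ => Nat.sub_add_cancel (hle i j)
    have h7 : ∑ j, (q • ν - stepCount a (W a)) j i + ∑ j, stepCount a (W a) j i =
        ∑ j, (q • ν) j i := by
      rw [← Finset.sum_add_distrib]
      exact Finset.sum_congr rfl fun j _ => Nat.sub_add_cancel (hle j i)
    lia
  obtain ⟨W', h4, h5⟩ := exists_closed_walk_add _ _ hbal rfl (W a) (h1 a) (h2 a)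
  refine ⟨W', h4, ?_⟩
  rw [h5]
  exact Matrix.ext fun i j => Nat.add_sub_of_le (hle i j)

/-- A positive entry of a power of a matrix with non-negative entries yields a walk along positive
entries. -/
lemma exists_walk_of_pow_pos {A : Matrix (Fin d) (Fin d) ℝ} (hA : ∀ i j, 0 ≤ A i j) (n : ℕ)
    {a b : Fin d} (h : 0 < (A ^ n) a b) :
    ∃ l : Vertex d, colour a l = b ∧ ∀ i j, A i j = 0 → stepCount a l i j = 0 := by
  induction n generalizing a with
  | zero =>
    refine ⟨[], ?_, by simp [stepCount]⟩
    by_contra hne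
    rw [pow_zero, Matrix.one_apply_ne (show a ≠ b from hne)] at h
    exact lt_irrefl _ h
  | succ n ih =>
    rw [pow_succ', Matrix.mul_apply] at h
    obtain ⟨c, hc⟩ : ∃ c, 0 < A a c * (A ^ n) c b := by
      by_contra! h'
      exact h.not_ge (Finset.sum_nonpos fun c _ => h' c)
    have hac : 0 < A a c := by
      refine (hA a c).lt_of_ne fun h0 => ?_
      simp [← h0] at hc
    obtain ⟨l, h1, h2⟩ := ih (pos_of_mul_pos_right hc (hA a c))
    refine ⟨c :: l, (colour_append a [c] l).trans h1, fun i j h0 => ?_⟩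
    rw [stepCount, Matrix.add_apply, h2 i j h0, add_zero, Matrix.single_apply, if_neg]
    rintro ⟨rfl, rfl⟩
    exact hac.ne' h0

lemma colour_replicate {a : Fin d} {W : Vertex d} (hW : colour a W = a) (n : ℕ) :
    colour a (List.replicate n W).flatten = a := by
  induction n with
  | zero => rfl
  | succ n ih => rw [List.replicate_succ, List.flatten_cons, colour_append, hW, ih]

lemma subtree_infinite {α : Fin d} {γ : ℕ} {ν : Matrix (Fin d) (Fin d) ℕ} {W : Vertex d}
    (hγ : 1 ≤ γ) (hW : colour α W = α) (hlen : W.length = γ) (hν : stepCount α W = ν) :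
    (subtree α γ ν).Infinite := by
  have hlr : ∀ n, (List.replicate n W).flatten.length = n * γ := by
    simp [hlen]
  have htake : ∀ n l, l ≤ n →
      (List.replicate n W).flatten.take (l * γ) = (List.replicate l W).flatten := by
    intro n l h
    obtain ⟨m, rfl⟩ := Nat.exists_eq_add_of_le h
    rw [List.replicate_add, List.flatten_append, List.take_left' (hlr l)]
  refine Set.infinite_of_injective_forall_mem (f := fun n => (List.replicate n W).flatten) ?_ ?_
  · intro m n h
    have := congrArg List.length h
    simp only [hlr] at this
    exact Nat.eq_of_mul_eq_mul_right hγ this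
  · intro n
    refine ⟨_, List.prefix_refl _, by rw [hlr]; exact dvd_mul_left γ n, fun l hl i j => ?_⟩
    rw [hlr] at hl
    have hl' : l + 1 ≤ n := Nat.le_of_mul_le_mul_right hl hγ
    rw [htake n l (by lia), htake n (l + 1) hl', List.replicate_succ', List.flatten_append,
      List.flatten_singleton, edgeCount_append, colour_replicate hW, hν]

/-- The level of `u` need not be a multiple of `γ`, so a path of length `(k + 1) * γ` is only
certain to contain `k` complete blocks. Types absent from `ν` are absent from all of `w`, which
consists of complete blocks. -/
lemma edgeCount_of_mem_subtree {α : Fin d} {γ : ℕ} {ν : Matrix (Fin d) (Fin d) ℕ}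
    {u v : Vertex d} (hγ : 1 ≤ γ) (hv : v ∈ subtree α γ ν) {k : ℕ}
    (hlen : v.length = u.length + (k + 1) * γ) (i j : Fin d) :
    k * ν i j ≤ edgeCount α u v i j ∧ (ν i j = 0 → edgeCount α u v i j = 0) := by
  obtain ⟨w, hvw, ⟨n, hn⟩, hw⟩ := hv
  set f : ℕ → ℕ := fun k =>
    if colour α (w.take k) = i ∧ colour α (w.take (k + 1)) = j then 1 else 0
  have hblock : ∀ m a, (a + m) * γ ≤ w.length →
      ∑ k ∈ Finset.Ico (a * γ) ((a + m) * γ), f k = m * ν i j := by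
    intro m a
    induction m with
    | zero => simp
    | succ m ih =>
      intro h
      rw [← add_assoc] at h
      have h1 : a * γ ≤ (a + m) * γ := Nat.mul_le_mul_right γ (by lia)
      have h2 : (a + m) * γ ≤ (a + m + 1) * γ := Nat.mul_le_mul_right γ (by lia)
      have h3 := hw (a + m) h i j
      rw [edgeCount_eq_sum α (List.take_prefix _ w), List.length_take, List.length_take,
        min_eq_left h, min_eq_left (h2.trans h)] at h3
      rw [← add_assoc, ← Finset.sum_Ico_consecutive f h1 h2, ih (h2.trans h), h3]
      ring
  have hvl := hvw.length_le
  rw [edgeCount_eq_sum α hvw]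
  constructor
  -- The quotient `|u| / γ` rounded up: block `a` is the first to start at or below `u`.
  · set a := (u.length + γ - 1) / γ with ha
    have h1 : u.length ≤ a * γ := by
      have := Nat.div_add_mod (u.length + γ - 1) γ
      have h2 := Nat.mod_lt (u.length + γ - 1) hγ
      rw [← ha, mul_comm] at this
      lia
    have h2 : a * γ < u.length + γ := by
      have := Nat.div_mul_le_self (u.length + γ - 1) γ
      lia
    have h3 : (a + k) * γ ≤ v.length := by
      rw [hlen, add_mul, add_mul]
      lia
    rw [← hblock k a (h3.trans hvl)]
    exact Finset.sum_le_sum_of_subset (Finset.Ico_subset_Ico h1 h3)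
  · intro h0
    have h1 := hblock n 0 (by rw [zero_add, hn, mul_comm])
    rw [h0, mul_zero] at h1
    refine Nat.le_zero.1 ((Finset.sum_le_sum_of_subset ?_).trans_eq h1)
    exact Finset.Ico_subset_Ico (by simp) (by rw [zero_add, mul_comm, ← hn]; exact hvl)

end Walks

/-! ### The method of types -/

section Types

open scoped Nat

lemma prod_pow_add_single {E : Type*} [Fintype E] [DecidableEq E] (x : E → ℝ) (D : E → ℕ) (e₀ : E) :
    ∏ e, x e ^ (D + Pi.single e₀ 1 : E → ℕ) e = (∏ e, x e ^ D e) * x e₀ := by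
  simp only [Pi.add_apply, pow_add, Finset.prod_mul_distrib]
  simp [Pi.single_apply, pow_ite]

lemma prod_factorial_add_single {E : Type*} [Fintype E] [DecidableEq E] (D : E → ℕ) (e₀ : E) :
    (∏ e, (((D + Pi.single e₀ 1 : E → ℕ) e)! : ℝ)) = (D e₀ + 1) * ∏ e, ((D e)! : ℝ) := by
  rw [← Finset.mul_prod_erase Finset.univ _ (Finset.mem_univ e₀),
    ← Finset.mul_prod_erase Finset.univ (fun e => ((D e)! : ℝ)) (Finset.mem_univ e₀), ← mul_assoc]
  congr 1
  · simp [Nat.factorial_succ]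
  · refine Finset.prod_congr rfl fun e he => ?_
    simp [(Finset.mem_erase.1 he).1]

variable {Ω κ T S : Type*} [MeasurableSpace Ω] {P : Measure Ω}
  [Fintype T] [Fintype S] [DecidableEq T] [DecidableEq S]

lemma real_inter_preimage_prod [DecidableEq κ] {X : κ → Ω → ℝ} (hX : iIndepFun X P)
    (hXm : ∀ k, AEMeasurable (X k) P) {K : Finset κ} {k : κ} (hk : k ∉ K) {s : Set ℝ}
    (hs : MeasurableSet s) (θ : ℝ) :
    P.real (X k ⁻¹' s ∩ {ω | θ ≤ ∏ j ∈ K, X j ω}) =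
      P.real (X k ⁻¹' s) * P.real {ω | θ ≤ ∏ j ∈ K, X j ω} := by
  have h := (hX.indepFun_finsetProd_of_notMem₀ hXm hk).symm.measure_inter_preimage_eq_mul s
    (Set.Ici θ) hs measurableSet_Ici
  have he : (∏ j ∈ K, X j) ⁻¹' Set.Ici θ = {ω | θ ≤ ∏ j ∈ K, X j ω} := by
    ext ω
    simp
  rw [he] at h
  simp only [measureReal_def, h, ENNReal.toReal_mul]

/-- The method of types: a lower bound for the probability that a product of independent variables
is at least a prescribed value, in terms of the numbers `D (τ, s)` of variables of type `τ` in the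
cell of `s`; the remaining `e` variables only have to be at least `b`. -/
lemma factorial_mul_le_real_prod [IsProbabilityMeasure P] {X : κ → Ω → ℝ} (hX : iIndepFun X P)
    (hXm : ∀ k, AEMeasurable (X k) P) (t : κ → T) {I : S → Set ℝ} {a : S → ℝ}
    (hI : ∀ s, MeasurableSet (I s)) (hdisj : ∀ s s', s ≠ s' → Disjoint (I s) (I s'))
    (ha : ∀ s, 0 < a s) (hIa : ∀ s, ∀ z ∈ I s, a s ≤ z)
    {p : T × S → ℝ} (hp : ∀ k s, P.real (X k ⁻¹' I s) = p (t k, s))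
    {b q : ℝ} (hb : 0 < b) (hq0 : 0 ≤ q) (hq : ∀ k, q ≤ P.real (X k ⁻¹' Set.Ici b))
    (K : Finset κ) (D : T × S → ℕ) (e : ℕ)
    (hD : ∀ τ, ∑ s, D (τ, s) ≤ (K.filter fun k => t k = τ).card)
    (hK : K.card = (∑ x, D x) + e) :
    (∏ τ, ((∑ s, D (τ, s))! : ℝ)) * (∏ x, p x ^ D x) * q ^ e ≤
      (∏ x, ((D x)! : ℝ)) *
        P.real {ω | (∏ x, a x.2 ^ D x) * b ^ e ≤ ∏ k ∈ K, X k ω} := by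
  classical
  induction K using Finset.induction_on generalizing D e with
  | empty =>
    obtain ⟨h1, rfl⟩ : ∑ x, D x = 0 ∧ e = 0 := by
      rw [Finset.card_empty] at hK
      lia
    obtain rfl : D = 0 := by
      funext x
      simpa using (Finset.sum_eq_zero_iff.1 h1) x (Finset.mem_univ x)
    simp
  | insert k K hk ih =>
    set τ₀ := t k with hτ₀
    have hcount : ∀ τ, ((insert k K).filter fun k => t k = τ).card =
        (K.filter fun k => t k = τ).card + if τ₀ = τ then 1 else 0 := by
      intro τ
      rw [Finset.filter_insert]
      split_ifs with h
      · rw [Finset.card_insert_of_notMem (by simp [hk])]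
      · rfl
    rw [Finset.card_insert_of_notMem hk] at hK
    have htot : ∑ x, D x = ∑ τ, ∑ s, D (τ, s) := Fintype.sum_prod_type D
    have hp0 : ∀ x, x.1 = τ₀ → 0 ≤ p x := by
      rintro ⟨τ, s⟩ rfl
      rw [← hp]
      exact measureReal_nonneg
    -- If the type of `k` is in surplus, `X k` is used as one of the `e` free variables. Otherwise
    -- every variable of this type is needed, and `X k` has to fall in a cell still in demand.
    by_cases hlt : ∑ s, D (τ₀, s) < ((insert k K).filter fun k => t k = τ₀).card
    · have hsum : ∑ τ, ∑ s, D (τ, s) < (insert k K).card := by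
        rw [Finset.card_eq_sum_card_fiberwise (f := t) (t := Finset.univ) (by simp)]
        exact Finset.sum_lt_sum (fun τ _ => hD τ) ⟨τ₀, Finset.mem_univ τ₀, hlt⟩
      rw [Finset.card_insert_of_notMem hk] at hsum
      obtain ⟨e, rfl⟩ : ∃ e', e = e' + 1 := ⟨e - 1, by lia⟩
      have hD' : ∀ τ, ∑ s, D (τ, s) ≤ (K.filter fun k => t k = τ).card := by
        intro τ
        by_cases h : τ₀ = τ
        · subst h
          rw [hcount, if_pos rfl] at hlt
          lia
        · simpa [hcount, h] using hD τ
      have h1 := ih D e hD' (by lia)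
      have h2 := real_inter_preimage_prod hX hXm hk (measurableSet_Ici (a := b))
        ((∏ x, a x.2 ^ D x) * b ^ e)
      have h3 : P.real (X k ⁻¹' Set.Ici b ∩
          {ω | (∏ x, a x.2 ^ D x) * b ^ e ≤ ∏ j ∈ K, X j ω}) ≤
          P.real {ω | (∏ x, a x.2 ^ D x) * b ^ (e + 1) ≤ ∏ j ∈ insert k K, X j ω} := by
        refine measureReal_mono ?_
        rintro ω ⟨hω1, hω2⟩
        simp only [Set.mem_preimage, Set.mem_Ici, Set.mem_ofPred_eq] at hω1 hω2 ⊢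
        rw [Finset.prod_insert hk, pow_succ, ← mul_assoc, mul_comm _ b]
        refine mul_le_mul hω1 hω2 (mul_nonneg ?_ (pow_pos hb e).le) (hb.le.trans hω1)
        exact Finset.prod_nonneg fun x _ => (pow_pos (ha x.2) _).le
      rw [h2] at h3
      have hF : 0 ≤ ∏ x, ((D x)! : ℝ) := by positivity
      calc (∏ τ, ((∑ s, D (τ, s))! : ℝ)) * (∏ x, p x ^ D x) * q ^ (e + 1)
          = q * ((∏ τ, ((∑ s, D (τ, s))! : ℝ)) * (∏ x, p x ^ D x) * q ^ e) := by ring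
        _ ≤ q * ((∏ x, ((D x)! : ℝ)) *
            P.real {ω | (∏ x, a x.2 ^ D x) * b ^ e ≤ ∏ j ∈ K, X j ω}) :=
            mul_le_mul_of_nonneg_left h1 hq0
        _ ≤ P.real (X k ⁻¹' Set.Ici b) * ((∏ x, ((D x)! : ℝ)) *
            P.real {ω | (∏ x, a x.2 ^ D x) * b ^ e ≤ ∏ j ∈ K, X j ω}) :=
            mul_le_mul_of_nonneg_right (hq k) (mul_nonneg hF measureReal_nonneg)
        _ = (∏ x, ((D x)! : ℝ)) * (P.real (X k ⁻¹' Set.Ici b) *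
            P.real {ω | (∏ x, a x.2 ^ D x) * b ^ e ≤ ∏ j ∈ K, X j ω}) := by ring
        _ ≤ _ := mul_le_mul_of_nonneg_left h3 hF
    · have heq : ∑ s, D (τ₀, s) = (K.filter fun k => t k = τ₀).card + 1 := by
        have h1 := hD τ₀
        rw [hcount, if_pos rfl] at h1 hlt
        lia
      set F : Finset S := Finset.univ.filter fun s => 0 < D (τ₀, s) with hF
      set A : Set Ω := {ω | (∏ x, a x.2 ^ D x) * b ^ e ≤ ∏ j ∈ insert k K, X j ω} with hA
      set θ : S → ℝ := fun s => (∏ x, a x.2 ^ (D - Pi.single (τ₀, s) 1 : T × S → ℕ) x) * b ^ e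
        with hθ
      have hDs : ∀ s ∈ F, D = (D - Pi.single (τ₀, s) 1) + Pi.single (τ₀, s) 1 := by
        intro s hs
        refine (tsub_add_cancel_of_le fun x => ?_).symm
        by_cases hx : x = (τ₀, s)
        · subst hx
          simpa [Nat.succ_le_iff] using (Finset.mem_filter.1 hs).2
        · simp [hx]
      -- The recursion for multinomial coefficients, free of division: the contribution of cell `s`
      -- carries the weight `D (τ₀, s)`, and these weights add up to the row total, which is
      -- cancelled at the end.
      have hstep : ∀ s ∈ F, (∏ τ, ((∑ s, D (τ, s))! : ℝ)) * (∏ x, p x ^ D x) * q ^ e * D (τ₀, s) ≤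
          (∑ s, D (τ₀, s) : ℕ) * ((∏ x, ((D x)! : ℝ)) *
            (p (τ₀, s) * P.real {ω | θ s ≤ ∏ j ∈ K, X j ω})) := by
        intro s hs
        have h0 := hDs s hs
        set D' : T × S → ℕ := D - Pi.single (τ₀, s) 1 with hD'
        have hrow : (fun τ => ∑ s, D (τ, s)) = (fun τ => ∑ s, D' (τ, s)) + Pi.single τ₀ 1 := by
          funext τ
          rw [h0]
          simp only [Pi.add_apply, Finset.sum_add_distrib]
          congr 1
          by_cases h : τ = τ₀
          · subst h
            simp [Pi.single_apply]
          · simp [h]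
        have hrow0 : ∑ s, D (τ₀, s) = ∑ s, D' (τ₀, s) + 1 := by
          simpa using congrFun hrow τ₀
        have h1 := ih D' e (fun τ => by
            have h1 := hD τ
            have h2 := congrFun hrow τ
            have h3 := hcount τ
            simp only [Pi.add_apply, Pi.single_apply, eq_comm (a := τ)] at h2
            lia) (by
            have : ∑ x, D x = ∑ x, D' x + 1 := by
              rw [h0]
              simp [Finset.sum_add_distrib]
            lia)
        have hfac : ∏ τ, ((∑ s, D (τ, s))! : ℝ) =
            (∑ s, D (τ₀, s) : ℕ) * ∏ τ, ((∑ s, D' (τ, s))! : ℝ) := by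
          rw [hrow0]
          have := prod_factorial_add_single (fun τ => ∑ s, D' (τ, s)) τ₀
          rw [← hrow] at this
          rw [this]
          push_cast
          rfl
        have hfac' : ∏ x, ((D x)! : ℝ) = D (τ₀, s) * ∏ x, ((D' x)! : ℝ) := by
          have h2 : D (τ₀, s) = D' (τ₀, s) + 1 := by
            conv_lhs => rw [h0]
            simp
          rw [h2]
          conv_lhs => rw [h0]
          rw [prod_factorial_add_single]
          push_cast
          rfl
        have hpow : ∏ x, p x ^ D x = (∏ x, p x ^ D' x) * p (τ₀, s) := by
          conv_lhs => rw [h0]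
          rw [prod_pow_add_single]
        have h3 : 0 ≤ (∑ s, D (τ₀, s) : ℕ) * (p (τ₀, s) * D (τ₀, s)) := by
          have := hp0 (τ₀, s) rfl
          positivity
        calc _ = (∑ s, D (τ₀, s) : ℕ) * (p (τ₀, s) * D (τ₀, s)) *
              ((∏ τ, ((∑ s, D' (τ, s))! : ℝ)) * (∏ x, p x ^ D' x) * q ^ e) := by
              rw [hfac, hpow]
              ring
          _ ≤ (∑ s, D (τ₀, s) : ℕ) * (p (τ₀, s) * D (τ₀, s)) *
              ((∏ x, ((D' x)! : ℝ)) * P.real {ω | θ s ≤ ∏ j ∈ K, X j ω}) :=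
              mul_le_mul_of_nonneg_left h1 h3
          _ = _ := by
              rw [hfac']
              ring
      have hunion : ∑ s ∈ F, p (τ₀, s) * P.real {ω | θ s ≤ ∏ j ∈ K, X j ω} ≤ P.real A := by
        have hprodm : AEMeasurable (fun ω => ∏ j ∈ K, X j ω) P :=
          Finset.aemeasurable_fun_prod K fun j _ => hXm j
        have h1 : P.real (⋃ s ∈ F, (X k ⁻¹' I s ∩ {ω | θ s ≤ ∏ j ∈ K, X j ω})) =
            ∑ s ∈ F, P.real (X k ⁻¹' I s ∩ {ω | θ s ≤ ∏ j ∈ K, X j ω}) := by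
          refine measureReal_biUnion_finset₀ (fun s _ s' _ hss => ?_) fun s _ => ?_
          · exact (((hdisj s s' hss).preimage (X k)).mono Set.inter_subset_left
              Set.inter_subset_left).aedisjoint
          · exact ((hXm k).nullMeasurableSet_preimage (hI s)).inter
              (hprodm.nullMeasurableSet_preimage measurableSet_Ici)
        rw [Finset.sum_congr rfl fun s _ => (congrArg₂ (· * ·) (hp k s).symm rfl :
          p (τ₀, s) * P.real {ω | θ s ≤ ∏ j ∈ K, X j ω} = _)]
        rw [← Finset.sum_congr rfl fun s _ => real_inter_preimage_prod hX hXm hk (hI s) (θ s), ← h1]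
        refine measureReal_mono ?_
        intro ω hω
        simp only [Set.mem_iUnion] at hω
        obtain ⟨s, hs, hω1, hω2⟩ := hω
        simp only [Set.mem_preimage, Set.mem_ofPred_eq] at hω1 hω2
        rw [hA, Set.mem_ofPred_eq, Finset.prod_insert hk, hDs s hs,
          prod_pow_add_single (fun x : T × S => a x.2)]
        have h4 := hIa s _ hω1
        calc _ = a s * θ s := by
              simp only [hθ]
              ring
          _ ≤ _ := mul_le_mul h4 hω2 (mul_nonneg (Finset.prod_nonneg fun x _ =>
              (pow_pos (ha x.2) _).le) (pow_pos hb e).le) ((ha s).le.trans h4)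
      have hn : (0 : ℝ) < (∑ s, D (τ₀, s) : ℕ) := by
        rw [heq]
        positivity
      have hsumF : ∑ s ∈ F, (D (τ₀, s) : ℝ) = (∑ s, D (τ₀, s) : ℕ) := by
        push_cast
        refine Finset.sum_subset (Finset.subset_univ F) fun s _ hs => ?_
        simpa [hF] using hs
      have hfin := Finset.sum_le_sum hstep
      rw [← Finset.mul_sum, ← Finset.mul_sum, ← Finset.mul_sum, hsumF, mul_comm] at hfin
      refine (le_of_mul_le_mul_left hfin hn).trans (mul_le_mul_of_nonneg_left hunion ?_)
      positivity

end Types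

/-! ### Logarithmic asymptotics and the entropy chain rule -/

section Asymptotics

open Filter
open scoped Nat

lemma le_log_factorial (n : ℕ) : n * Real.log n - n ≤ Real.log (n ! : ℝ) := by
  rcases Nat.eq_zero_or_pos n with rfl | hn
  · simp
  have hn' : (0 : ℝ) < n := by exact_mod_cast hn
  have h := Real.pow_div_factorial_le_exp (n : ℝ) hn'.le n
  have hf : (0 : ℝ) < n ! := by positivity
  have h1 := Real.log_le_log (by positivity) h
  rw [Real.log_div (by positivity) hf.ne', Real.log_pow, Real.log_exp] at h1
  linarith

/-- A crude Stirling bound: a logarithmic error is enough, since it competes with a linear gain in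
`k`. -/
lemma log_factorial_le (n : ℕ) :
    Real.log (n ! : ℝ) ≤ n * Real.log n - n + (1 + Real.log n) := by
  induction n with
  | zero => simp
  | succ n ih =>
    rcases Nat.eq_zero_or_pos n with rfl | hn
    · simp
    have hn' : (0 : ℝ) < n := by exact_mod_cast hn
    have hf : (0 : ℝ) < n ! := by positivity
    have h1 : 1 ≤ (n + 1) * (Real.log (n + 1) - Real.log n) := by
      have h2 := Real.one_sub_inv_le_log_of_pos (x := (n + 1) / n) (by positivity)
      rw [Real.log_div (by positivity) hn'.ne', inv_div] at h2
      have h3 : 1 - (n : ℝ) / (n + 1) = 1 / (n + 1) := by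
        field_simp
        ring
      rw [h3, div_le_iff₀ (by positivity)] at h2
      linarith
    rw [Nat.factorial_succ]
    push_cast
    rw [Real.log_mul (by positivity) hf.ne']
    nlinarith

lemma mul_log_mul (k c : ℕ) (hk : 1 ≤ k) : ((k * c : ℕ) : ℝ) * Real.log ((k * c : ℕ) : ℝ) =
    k * (c * Real.log k) + k * (c * Real.log c) := by
  rcases Nat.eq_zero_or_pos c with rfl | hc
  · simp
  have hk' : (k : ℝ) ≠ 0 := by positivity
  have hc' : (c : ℝ) ≠ 0 := by positivity
  push_cast
  rw [Real.log_mul hk' hc']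
  ring

/-- In Stirling's formula the `log k` terms and the linear terms of the row factorials cancel those
of the cell factorials; only one logarithmic error per pair `(τ, s)` survives. -/
lemma log_typeClass_lower {T S : Type*} [Fintype T] [Fintype S] {c : T × S → ℕ} {p : T × S → ℝ}
    (hp : ∀ x, c x ≠ 0 → 0 < p x) {k : ℕ} (hk : 1 ≤ k) :
    k * (∑ x, c x * Real.log ((∑ s, c (x.1, s) : ℕ) * p x / c x)) -
        Fintype.card (T × S) * (1 + Real.log (k * (∑ x, c x : ℕ))) +
        ∑ x, Real.log ((k * c x)! : ℝ) ≤
      (∑ τ, Real.log ((∑ s, k * c (τ, s))! : ℝ)) + ∑ x, (k * c x : ℕ) * Real.log (p x) := by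
  have h1 : ∀ x, (k : ℝ) * (c x * Real.log ((∑ s, c (x.1, s) : ℕ) * p x / c x)) =
      k * (c x * Real.log (∑ s, c (x.1, s) : ℕ)) + k * (c x * Real.log (p x)) -
      k * (c x * Real.log (c x)) := by
    intro x
    rcases Nat.eq_zero_or_pos (c x) with h0 | h0
    · simp [h0]
    have h2 : 0 < ∑ s, c (x.1, s) := h0.trans_le
      (Finset.single_le_sum (f := fun s => c (x.1, s)) (fun _ _ => Nat.zero_le _)
        (Finset.mem_univ x.2))
    have h3 : ((∑ s, c (x.1, s) : ℕ) : ℝ) ≠ 0 := by positivity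
    have h4 : (c x : ℝ) ≠ 0 := by positivity
    rw [Real.log_div (mul_ne_zero h3 (hp x h0.ne').ne') h4, Real.log_mul h3 (hp x h0.ne').ne']
    ring
  have h2 : ∀ x, Real.log ((k * c x)! : ℝ) ≤ k * (c x * Real.log k) + k * (c x * Real.log (c x)) -
      (k * c x : ℕ) + (1 + Real.log (k * (∑ x, c x : ℕ))) := by
    intro x
    have h3 := log_factorial_le (k * c x)
    rw [mul_log_mul k (c x) hk] at h3
    have h4 : Real.log ((k * c x : ℕ) : ℝ) ≤ Real.log (k * (∑ x, c x : ℕ)) := by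
      rcases Nat.eq_zero_or_pos (c x) with h0 | h0
      · rw [h0, mul_zero, Nat.cast_zero, Real.log_zero, ← Nat.cast_mul]
        exact Real.log_natCast_nonneg _
      · refine Real.log_le_log (by positivity) ?_
        rw [← Nat.cast_mul]
        exact Nat.cast_le.2 (Nat.mul_le_mul_left k
          (Finset.single_le_sum (fun _ _ => Nat.zero_le _) (Finset.mem_univ x)))
    linarith
  have h3 : ∀ τ, ∑ s, (k * (c (τ, s) * Real.log k) +
      k * (c (τ, s) * Real.log (∑ s, c (τ, s) : ℕ)) - (k * c (τ, s) : ℕ)) ≤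
      Real.log ((∑ s, k * c (τ, s))! : ℝ) := by
    intro τ
    have h4 := le_log_factorial (k * ∑ s, c (τ, s))
    rw [mul_log_mul k _ hk] at h4
    rw [← Finset.mul_sum]
    refine le_trans (le_of_eq ?_) h4
    push_cast
    simp only [Finset.sum_sub_distrib, Finset.sum_add_distrib, ← Finset.mul_sum, ← Finset.sum_mul]
  have h4 := Finset.sum_le_sum fun x (_ : x ∈ Finset.univ) => h2 x
  have h5 := Finset.sum_le_sum fun τ (_ : τ ∈ Finset.univ) => h3 τ
  rw [← Fintype.sum_prod_type (f := fun x : T × S => ((k : ℝ) * (c x * Real.log k) +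
      k * (c x * Real.log (∑ s, c (x.1, s) : ℕ)) - (k * c x : ℕ)))] at h5
  rw [Finset.mul_sum, Finset.sum_congr rfl fun x _ => h1 x]
  simp only [Finset.sum_sub_distrib, Finset.sum_add_distrib, Finset.sum_const, Finset.card_univ,
    nsmul_eq_mul] at h4 h5 ⊢
  have h6 : ∑ x, ((k * c x : ℕ) : ℝ) * Real.log (p x) = ∑ x, (k : ℝ) * (c x * Real.log (p x)) :=
    Finset.sum_congr rfl fun x _ => by
      push_cast
      ring
  rw [h6]
  linarith

lemma eventually_add_mul_log_lt (A B : ℝ) {δ : ℝ} (hδ : 0 < δ) :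
    ∀ᶠ k : ℕ in atTop, B + A * Real.log k < k * δ := by
  have h1 : (fun k : ℕ => A * Real.log k) =o[atTop] fun k : ℕ => (k : ℝ) :=
    (Real.isLittleO_log_id_atTop.comp_tendsto tendsto_natCast_atTop_atTop).const_mul_left A
  have h2 : Tendsto (fun k : ℕ => (k : ℝ) * (δ / 2)) atTop atTop :=
    tendsto_natCast_atTop_atTop.atTop_mul_const (half_pos hδ)
  filter_upwards [h1.bound (half_pos hδ), h2.eventually_gt_atTop B] with k hk1 hk2
  rw [Real.norm_eq_abs, Real.norm_of_nonneg (Nat.cast_nonneg k)] at hk1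
  have := le_abs_self (A * Real.log k)
  linarith

lemma psi_pos {d : ℕ} {β : Matrix (Fin d) (Fin d) ℝ} (hβ : ∀ i j, 0 ≤ β i j) : 0 < psi β := by
  refine Finset.prod_pos fun i _ => Finset.prod_pos fun k _ => ?_
  rcases (hβ i k).eq_or_lt with h | h
  · simp [← h]
  · refine Real.rpow_pos_of_pos (div_pos (h.trans_le ?_) h) _
    exact Finset.single_le_sum (f := fun j => β i j) (fun j _ => hβ i j) (Finset.mem_univ k)

lemma mul_log_psi {d : ℕ} {β : Matrix (Fin d) (Fin d) ℝ} {ν : Matrix (Fin d) (Fin d) ℕ} {γ : ℕ}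
    (hγ : 1 ≤ γ) (hβ : ∀ i j, β i j = ν i j / γ) :
    γ * Real.log (psi β) = ∑ i, ∑ j, ν i j * Real.log ((∑ k, ν i k : ℕ) / ν i j) := by
  have hγ' : (γ : ℝ) ≠ 0 := by positivity
  have hterm : ∀ i k, 0 < ((∑ j, β i j) / β i k) ^ (β i k) ∧
      γ * Real.log (((∑ j, β i j) / β i k) ^ (β i k)) =
        ν i k * Real.log ((∑ j, ν i j : ℕ) / ν i k) := by
    intro i k
    have hr : (∑ j, β i j) / β i k = (∑ j, ν i j : ℕ) / ν i k := by
      simp only [hβ, ← Finset.sum_div]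
      rw [div_div_div_cancel_right₀ hγ']
      push_cast
      rfl
    rw [hr]
    rcases Nat.eq_zero_or_pos (ν i k) with h | h
    · simp [hβ, h]
    · have h1 : 0 < ∑ j, ν i j := h.trans_le
        (Finset.single_le_sum (f := fun j => ν i j) (fun _ _ => Nat.zero_le _) (Finset.mem_univ k))
      have h2 : (0 : ℝ) < (∑ j, ν i j : ℕ) / ν i k := by positivity
      refine ⟨Real.rpow_pos_of_pos h2 _, ?_⟩
      rw [Real.log_rpow h2, hβ]
      field_simp
  rw [psi, Real.log_prod (fun i _ => (Finset.prod_pos fun k _ => (hterm i k).1).ne'),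
    Finset.mul_sum]
  refine Finset.sum_congr rfl fun i _ => ?_
  rw [Real.log_prod (fun k _ => (hterm i k).1.ne'), Finset.mul_sum]
  exact Finset.sum_congr rfl fun k _ => (hterm i k).2

/-- Chain rule: the entropy splits into that of the cells given the step types and that of the step
types. By `mul_log_psi` the latter is `γ log ψ(β)`. -/
lemma flowEntropy_eq {d : ℕ} {S : Type*} [Fintype S] {p : Fin d → Fin d → S → ℝ}
    {c : Fin d → Fin d → S → ℕ} (hp : ∀ i j s, c i j s ≠ 0 → 0 < p i j s) :
    flowEntropy p (fun i j s => (c i j s : ℝ)) =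
      (∑ x : (Fin d × Fin d) × S, (c x.1.1 x.1.2 x.2 : ℝ) *
        Real.log ((∑ s, c x.1.1 x.1.2 s : ℕ) * p x.1.1 x.1.2 x.2 / c x.1.1 x.1.2 x.2)) +
      ∑ i, ∑ j, (∑ s, c i j s : ℕ) *
        Real.log ((∑ k, ∑ s, c i k s : ℕ) / (∑ s, c i j s : ℕ)) := by
  simp only [Fintype.sum_prod_type, ← Finset.sum_add_distrib, flowEntropy]
  refine Finset.sum_congr rfl fun i _ => Finset.sum_congr rfl fun j _ => ?_
  rw [Nat.cast_sum, Finset.sum_mul, ← Finset.sum_add_distrib]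
  refine Finset.sum_congr rfl fun s _ => ?_
  rcases Nat.eq_zero_or_pos (c i j s) with h0 | h0
  · simp [h0]
  have h1 : 0 < ∑ s, c i j s := h0.trans_le
    (Finset.single_le_sum (f := fun s => c i j s) (fun _ _ => Nat.zero_le _) (Finset.mem_univ s))
  have h2 : 0 < ∑ k, ∑ s, c i k s := h1.trans_le
    (Finset.single_le_sum (f := fun k => ∑ s, c i k s) (fun _ _ => Nat.zero_le _)
      (Finset.mem_univ j))
  have h3 := hp i j s h0.ne'
  have h1' : (0 : ℝ) < (∑ s, c i j s : ℕ) := by exact_mod_cast h1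
  have h2' : (0 : ℝ) < (∑ k, ∑ s, c i k s : ℕ) := by exact_mod_cast h2
  have h0' : (0 : ℝ) < c i j s := by exact_mod_cast h0
  push_cast at h1' h2' ⊢
  rw [← mul_add, ← Real.log_mul (by positivity) (by positivity)]
  congr 2
  field_simp

end Asymptotics

/-! ### Choice of the base `y` -/

section Exponents

open Filter
open scoped Nat

/-- For a good integer flow, the method-of-types lower bound beats the required exponential rate. -/
lemma IsGoodFlow.exists_rate {d : ℕ} {S : Type*} [Fintype S] {p : Fin d → Fin d → S → ℝ}
    {a : S → ℝ} {c : Fin d → Fin d → S → ℕ}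
    (h : IsGoodFlow p a (fun i j s => (c i j s : ℝ))) (hp : ∀ i j s, 0 ≤ p i j s)
    (ha : ∀ s, 0 < a s) {b q : ℝ} (hb : 0 < b) (hq : 0 < q) {γ : ℕ} (hγ : 1 ≤ γ)
    (hγc : γ = ∑ x : (Fin d × Fin d) × S, c x.1.1 x.1.2 x.2)
    {β : Matrix (Fin d) (Fin d) ℝ} (hβ : ∀ i j, β i j = (∑ s, c i j s : ℕ) / γ) :
    ∃ y : ℝ, 0 < y ∧ y ≤ 1 ∧ ∃ N : ℕ, 1 ≤ N ∧ ∀ k : ℕ, N ≤ k →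
      y ^ (γ * (k + 1)) <
        (∏ x : (Fin d × Fin d) × S, a x.2 ^ (k * c x.1.1 x.1.2 x.2)) * b ^ γ ∧
      (1 / (y * psi β)) ^ (γ * (k + 1)) *
          ∏ x : (Fin d × Fin d) × S, ((k * c x.1.1 x.1.2 x.2)! : ℝ) <
        (∏ τ : Fin d × Fin d, ((∑ s, k * c τ.1 τ.2 s)! : ℝ)) *
          (∏ x : (Fin d × Fin d) × S, p x.1.1 x.1.2 x.2 ^ (k * c x.1.1 x.1.2 x.2)) * q ^ γ := by
  have hpc : ∀ i j s, c i j s ≠ 0 → 0 < p i j s := fun i j s h0 =>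
    (hp i j s).lt_of_ne fun h1 => h0 (Nat.cast_eq_zero.1 ((h.2.1 i j s).2 h1.symm))
  have hψ : 0 < psi β := psi_pos fun i j => by
    rw [hβ]
    positivity
  have hG := flowEntropy_eq hpc
  rw [← mul_log_psi hγ hβ] at hG
  set c' : (Fin d × Fin d) × S → ℕ := fun x => c x.1.1 x.1.2 x.2 with hc'
  set p' : (Fin d × Fin d) × S → ℝ := fun x => p x.1.1 x.1.2 x.2 with hp'
  set H := ∑ x : (Fin d × Fin d) × S, (c x.1.1 x.1.2 x.2 : ℝ) *
        Real.log ((∑ s, c x.1.1 x.1.2 s : ℕ) * p x.1.1 x.1.2 x.2 / c x.1.1 x.1.2 x.2) with hH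
  set G := flowEntropy p (fun i j s => (c i j s : ℝ))
  set L := flowDrift a (fun i j s => (c i j s : ℝ)) with hL
  have hLsum : ∑ x, (c' x : ℝ) * Real.log (a x.2) = L := by
    simp only [hL, flowDrift, hc', Fintype.sum_prod_type]
  -- Half of the available gain: `δ` per block is given up in the value collected, and `δ` per block
  -- remains for the probability.
  set δ := (G + min 0 L) / 2 with hδ
  have hδ0 : 0 < δ := by
    refine half_pos ?_
    rcases min_choice 0 L with h0 | h0 <;> rw [h0]
    · simpa using h.2.2.2.1
    · exact h.2.2.2.2
  have hγ0 : (0 : ℝ) < γ := by exact_mod_cast hγ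
  set y := Real.exp ((min 0 L - δ) / γ) with hy
  have hlogy : γ * Real.log y = min 0 L - δ := by
    rw [hy, Real.log_exp]
    field_simp
  have hy0 : 0 < y := Real.exp_pos _
  set n : ℝ := ((Fintype.card ((Fin d × Fin d) × S) : ℕ) : ℝ)
  have hn0 : 0 ≤ n := Nat.cast_nonneg _
  obtain ⟨N, hN⟩ := eventually_atTop.1
    (((eventually_add_mul_log_lt n (n * (1 + Real.log γ) + H - γ * Real.log q) hδ0).and
      (eventually_add_mul_log_lt 0 (L - γ * Real.log b) hδ0)))
  refine ⟨y, hy0, ?_, N + 1, by lia, fun k hk => ?_⟩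
  · rw [hy, Real.exp_le_one_iff]
    exact div_nonpos_of_nonpos_of_nonneg (by linarith [min_le_left 0 L]) hγ0.le
  have hk1 : 1 ≤ k := by lia
  have hk0 : (0 : ℝ) < k := by exact_mod_cast hk1
  obtain ⟨-, h2⟩ := hN (k + 1) (by lia)
  obtain ⟨h1, -⟩ := hN k (by lia)
  push_cast at h2
  have hk2 : (1 : ℝ) ≤ k := by exact_mod_cast hk1
  constructor
  · have hA : 0 < ∏ x, a x.2 ^ (k * c' x) := Finset.prod_pos fun x _ => pow_pos (ha x.2) _
    refine (Real.log_lt_log_iff (pow_pos hy0 _) (mul_pos hA (pow_pos hb _))).1 ?_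
    have e1 : Real.log (∏ x, a x.2 ^ (k * c' x)) = k * L := by
      rw [Real.log_prod fun x _ => (pow_pos (ha x.2) _).ne', ← hLsum, Finset.mul_sum]
      refine Finset.sum_congr rfl fun x _ => ?_
      rw [Real.log_pow]
      push_cast
      ring
    rw [Real.log_mul hA.ne' (pow_pos hb _).ne', e1, Real.log_pow, Real.log_pow]
    push_cast
    have e2 : (γ : ℝ) * (k + 1) * Real.log y = (k + 1) * (min 0 L - δ) := by
      rw [← hlogy]
      ring
    rw [e2]
    nlinarith [min_le_right 0 L]
  · have hF : 0 < ∏ x, ((k * c' x)! : ℝ) := Finset.prod_pos fun x _ => by positivity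
    have hF' : 0 < ∏ τ : Fin d × Fin d, ((∑ s, k * c' (τ, s))! : ℝ) :=
      Finset.prod_pos fun x _ => by positivity
    have hpow : ∀ x, 0 < p' x ^ (k * c' x) := by
      intro x
      rcases Nat.eq_zero_or_pos (c' x) with h0 | h0
      · simp [h0]
      · exact pow_pos (hpc _ _ _ h0.ne') _
    have hQ : 0 < ∏ x, p' x ^ (k * c' x) := Finset.prod_pos fun x _ => hpow x
    have hyψ : 0 < 1 / (y * psi β) := by positivity
    refine (Real.log_lt_log_iff (mul_pos (pow_pos hyψ _) hF)
      (mul_pos (mul_pos hF' hQ) (pow_pos hq _))).1 ?_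
    have e1 := log_typeClass_lower (c := c') (p := p') (fun x => hpc _ _ _) hk1
    rw [Real.log_mul (pow_pos hyψ _).ne' hF.ne', Real.log_mul (mul_pos hF' hQ).ne'
      (pow_pos hq _).ne', Real.log_mul hF'.ne' hQ.ne', Real.log_pow, Real.log_pow, one_div,
      Real.log_inv, Real.log_mul hy0.ne' hψ.ne', Real.log_prod fun x _ => (hpow x).ne',
      Real.log_prod fun x _ => by positivity, Real.log_prod fun x _ => by positivity]
    simp only [Real.log_pow]
    have e2 : Real.log (k * (∑ x, c' x : ℕ)) = Real.log k + Real.log γ := by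
      rw [← hγc, Real.log_mul hk0.ne' hγ0.ne']
    have e3 : ((γ * (k + 1) : ℕ) : ℝ) * -(Real.log y + Real.log (psi β)) =
        -(k + 1) * ((min 0 L - δ) + (G - H)) := by
      rw [← hlogy, hG]
      push_cast
      ring
    rw [e2] at e1
    rw [e3]
    change k * H - _ + _ ≤ _ at e1
    -- The required exponent becomes `(k + 1) * (H - δ)`. It lies below `k * H` by about `k * δ`,
    -- which absorbs the logarithmic errors and the constant `γ log q`.
    have e4 : min 0 L = 2 * δ - G := by
      rw [hδ]
      ring
    rw [e4]
    nlinarith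
end Exponents

/-! ### Edge variables along a path -/

section Environment

variable {d : ℕ} {Ω' Ω : Type*} {α : Fin d} {ξ : Vertex d → Ω → ℝ}

/-- The edge variable of the `m`-th step of the path from `u` to `u ++ l`. -/
def stepVar (ξ : Vertex d → Ω → ℝ) (u l : Vertex d) (m : Fin l.length) : Ω → ℝ :=
  ξ ((u ++ l.take m) ++ [l[m]])

/-- The chromatic type of the `m`-th step of the path from `u` to `u ++ l`. -/
def stepType (α : Fin d) (u l : Vertex d) (m : Fin l.length) : Fin d × Fin d :=
  (colour α (u ++ l.take m), l[m])

lemma take_append_step (u l : Vertex d) (m : Fin l.length) :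
    (u ++ l).take (u.length + m + 1) = (u ++ l.take m) ++ [l[m]] := by
  rw [add_assoc, List.take_length_add_append, List.take_succ_eq_append_getElem m.2,
    List.append_assoc]
  rfl

lemma pathProd_append (u l : Vertex d) (ω : Ω) :
    pathProd ξ u (u ++ l) ω = ∏ m, stepVar ξ u l m ω := by
  rw [pathProd, Finset.prod_Ico_eq_prod_range, List.length_append, Nat.add_sub_cancel_left,
    Finset.prod_range]
  refine Finset.prod_congr rfl fun m _ => ?_
  rw [take_append_step, stepVar]

lemma card_stepType (u l : Vertex d) (i j : Fin d) :
    (Finset.univ.filter fun m => stepType α u l m = (i, j)).card =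
      edgeCount α u (u ++ l) i j := by
  rw [edgeCount_eq_sum α (List.prefix_refl _), Finset.sum_Ico_eq_sum_range, List.length_append,
    Nat.add_sub_cancel_left, Finset.sum_range, Finset.card_filter]
  refine Finset.sum_congr rfl fun m _ => ?_
  rw [take_append_step, List.take_length_add_append]
  have : colour α (u ++ l.take m ++ [l[m]]) = l[m] :=
    colour_append α (u ++ l.take m) [l[m]]
  rw [this]
  simp [stepType]

variable [MeasurableSpace Ω'] [MeasurableSpace Ω] {η : Fin d → Fin d → Ω' → ℝ} {P' : Measure Ω'}
  {P : Measure Ω}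

lemma IsEdgeEnvironment.identDistrib_stepVar (h : IsEdgeEnvironment α η P' ξ P) (u l : Vertex d)
    (m : Fin l.length) :
    IdentDistrib (stepVar ξ u l m) (η (stepType α u l m).1 (stepType α u l m).2) P P' :=
  h.identDistrib (u ++ l.take m) l[m]

/-- The steps of a path leave distinct vertices, so at most one coordinate of each independent
vector is used and dependence between siblings does not matter. -/
lemma IsEdgeEnvironment.iIndepFun_stepVar (h : IsEdgeEnvironment α η P' ξ P) (u l : Vertex d) :
    iIndepFun (stepVar ξ u l) P := by
  have hinj : Function.Injective fun m : Fin l.length => u ++ l.take m := by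
    intro m n hmn
    have := congrArg List.length hmn
    simp only [List.length_append, List.length_take, min_eq_left m.2.le, min_eq_left n.2.le] at this
    exact Fin.ext (by lia)
  exact (h.indep.precomp hinj).comp (fun m f => f l[m]) fun m => measurable_pi_apply _

end Environment

lemma exists_pos_le {E : Type*} [Finite E] (f : E → ℝ) : ∃ q > 0, ∀ e, 0 < f e → q ≤ f e := by
  have h : ∀ e, ∀ᶠ q in nhdsWithin (0 : ℝ) (Set.Ioi 0), 0 < f e → q ≤ f e := by
    intro e
    by_cases he : 0 < f e
    · filter_upwards [Ioc_mem_nhdsGT he] with q hq _ using hq.2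
    · exact Filter.Eventually.of_forall fun q hq => absurd hq he
  obtain ⟨q, h1, h2⟩ := ((Filter.eventually_all.2 h).and self_mem_nhdsWithin).exists
  exact ⟨q, h2, h1⟩

/-! ### From the moment matrices to a discrete good flow -/

section Moments

open Matrix

variable {d : ℕ} {Ω' : Type*} [MeasurableSpace Ω'] {P' : Measure Ω'} {η : Fin d → Fin d → Ω' → ℝ}

lemma momentMatrix_nonneg (h0 : ∀ i j, ∀ᵐ ω ∂P', 0 ≤ η i j ω) (x : ℝ) (i j : Fin d) :
    0 ≤ momentMatrix η P' x i j := by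
  refine integral_nonneg_of_ae ?_
  filter_upwards [h0 i j] with ω hω using Real.rpow_nonneg hω x

/-- For an eigenvector `w` with eigenvalue `t`, the vector `|w|` satisfies `t |w| ≤ A |w|`; pair it
with `u`. The condition `0 ≤ r` covers the absence of real eigenvalues, where the supremum is zero.
-/
lemma largestEigenvalue_le {A : Matrix (Fin d) (Fin d) ℝ} (hA : ∀ i j, 0 ≤ A i j) {u : Fin d → ℝ}
    (hu : ∀ i, 0 < u i) {r : ℝ} (hr : 0 ≤ r) (h : ∀ j, (u ᵥ* A) j ≤ r * u j) :
    largestEigenvalue A ≤ r := by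
  refine Real.sSup_le ?_ hr
  intro t ht
  obtain ⟨w, hw⟩ := Module.End.HasEigenvalue.exists_hasEigenvector ht
  have hw1 : A *ᵥ w = t • w := by
    simpa using hw.apply_eq_smul
  obtain ⟨i, hi⟩ := Function.ne_iff.1 hw.2
  refine eigenvalue_le_of_subsolution (w := fun i => |w i|) (fun i => (hu i).le)
    (fun i => abs_nonneg _) ?_ h fun i => ?_
  · exact Finset.sum_pos' (fun k _ => mul_nonneg (hu k).le (abs_nonneg _))
      ⟨i, Finset.mem_univ i, mul_pos (hu i) (abs_pos.2 hi)⟩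
  · calc t * |w i| ≤ |t| * |w i| := mul_le_mul_of_nonneg_right (le_abs_self t) (abs_nonneg _)
      _ = |(A *ᵥ w) i| := by rw [hw1, Pi.smul_apply, smul_eq_mul, abs_mul]
      _ ≤ ∑ j, |A i j * w j| := Finset.abs_sum_le_sum_abs (fun j => A i j * w j) Finset.univ
      _ = (A *ᵥ fun i => |w i|) i := Finset.sum_congr rfl fun j _ => by
          rw [abs_mul, abs_of_nonneg (hA i j)]

/-- A real infimum over a family unbounded below is zero by convention, which `1 < lam η P'`
excludes. -/
lemma lam_le_largestEigenvalue (hlam : 1 < lam η P') {x : ℝ} (hx : x ∈ Set.Icc (0 : ℝ) 1) :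
    lam η P' ≤ largestEigenvalue (momentMatrix η P' x) := by
  have hbdd : BddBelow (Set.range fun x : Set.Icc (0 : ℝ) 1 =>
      largestEigenvalue (momentMatrix η P' (x : ℝ))) := by
    by_contra h
    rw [lam, Real.iInf_of_not_bddBelow h] at hlam
    linarith
  exact ciInf_le hbdd ⟨x, hx⟩

lemma pos_of_one_lt_lam (hlam : 1 < lam η P') : 0 < d := by
  rcases Nat.eq_zero_or_pos d with rfl | h
  · have h0 := lam_le_largestEigenvalue hlam (x := 1) (by simp)
    have h1 := largestEigenvalue_le (A := momentMatrix η P' 1) (fun i => i.elim0)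
      (u := fun _ => 1) (fun i => i.elim0) le_rfl (fun i => i.elim0)
    linarith
  · exact h

/-- After discretization of the entries of `η` there is a good integer flow, with strongly
connected support. -/
lemma exists_discrete_flow [IsProbabilityMeasure P']
    (h0 : ∀ i j, ∀ᵐ ω ∂P', 0 ≤ η i j ω) (hint : ∀ i j, Integrable (η i j) P')
    (hreg : IsRegular η P') (hlam : 1 < lam η P') :
    ∃ (S : Finset ℤ) (I : S → Set ℝ) (a : S → ℝ) (c : Fin d → Fin d → S → ℕ),
      (∀ s, MeasurableSet (I s)) ∧ (∀ s s', s ≠ s' → Disjoint (I s) (I s')) ∧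
      (∀ s, 0 < a s) ∧ (∀ s, ∀ z ∈ I s, a s ≤ z) ∧
      IsGoodFlow (fun i j s => P'.real (η i j ⁻¹' I s)) a (fun i j s => (c i j s : ℝ)) ∧
      ∀ a b, ∃ l : Vertex d, colour a l = b ∧
        ∀ i j, ∑ s, c i j s = 0 → stepCount a l i j = 0 := by
  have hd : Nonempty (Fin d) := ⟨⟨0, pos_of_one_lt_lam hlam⟩⟩
  have hm : ∀ i j, AEMeasurable (η i j) P' := fun i j => (hint i j).aemeasurable
  set μ : Fin d × Fin d → Measure ℝ := fun e => P'.map (η e.1 e.2) with hμ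
  have hμp : ∀ e, IsProbabilityMeasure (μ e) := fun e =>
    Measure.isProbabilityMeasure_map (hm e.1 e.2)
  set lm := lam η P'
  -- Halfway between `1` and `λ`; `ε` is the relative loss that discretization may cause, with `(1 -
  -- ε) * λ = r₀`.
  set r₀ := (lm + 1) / 2 with hr₀
  set ε := (lm - 1) / (2 * lm) with hε
  have hlm0 : 0 < lm := by linarith
  have hε0 : 0 < ε := div_pos (by linarith) (by linarith)
  have hε1 : (1 - ε) * lm = r₀ := by
    rw [hε, hr₀]
    field_simp
    ring
  have hr1 : 1 < r₀ := by linarith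
  have hε2 : 0 < 1 - ε := pos_of_mul_pos_left (by rw [hε1]; linarith) hlm0.le
  obtain ⟨δ, hδ, m, hgrid⟩ := exists_grid μ
    (fun e => (ae_map_iff (hm e.1 e.2) measurableSet_Ici).2 (h0 e.1 e.2))
    (fun e => (integrable_map_measure aestronglyMeasurable_id (hm e.1 e.2)).2 (hint e.1 e.2))
    hε0 (by linarith)
  set S : Finset ℤ := Finset.Ico (-m : ℤ) m
  set p : Fin d → Fin d → S → ℝ := fun i j s => P'.real (η i j ⁻¹' cell δ s) with hp
  set a : S → ℝ := fun s => Real.exp (δ * s) with ha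
  have hB : ∀ x ∈ Set.Ioc (0 : ℝ) 1, ∀ i j,
      ((1 - ε) • momentMatrix η P' x) i j ≤ symbolMatrix p a x i j := by
    intro x hx i j
    have h1 := hgrid (i, j) x hx
    have h2 : ∫ t, t ^ x ∂(P'.map (η i j)) = momentMatrix η P' x i j :=
      integral_map (f := fun t => t ^ x) (hm i j) (measurable_id.pow_const x).aestronglyMeasurable
    simp only [hμ] at h1
    rw [h2, ← Finset.sum_coe_sort] at h1
    refine h1.trans_eq (Finset.sum_congr rfl fun s _ => ?_)
    rw [hp, ha, map_measureReal_apply_of_aemeasurable (hm i j) (measurableSet_cell δ s)]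
  have hp0 : ∀ i j s, 0 ≤ p i j s := fun i j s => measureReal_nonneg
  have ha0 : ∀ s, 0 < a s := fun s => Real.exp_pos _
  have hsc : ∀ x i j, 0 ≤ ((1 - ε) • momentMatrix η P' x) i j := fun x i j =>
    mul_nonneg hε2.le (momentMatrix_nonneg h0 x i j)
  obtain ⟨M, hM⟩ := hreg
  have hpow : ∀ x ∈ Set.Ioc (0 : ℝ) 1, ∀ i j, 0 < (symbolMatrix p a x ^ M) i j := by
    intro x hx i j
    refine lt_of_lt_of_le ?_ (pow_apply_le_pow_apply (hsc x) (hB x hx) M i j).2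
    rw [smul_pow]
    exact mul_pos (pow_pos hε2 M) (hM x (Set.Ioc_subset_Icc_self hx) i j)
  have hlog : 0 < Real.log r₀ := Real.log_pos hr1
  -- The exponent zero is out of reach because the cells ignore atoms at zero. With `κ = exp (δ *
  -- m)`, this `x₀` is small enough for `x₀ log κ < log r₀`.
  set x₀ := min 1 (Real.log r₀ / (2 * (δ * m + 1))) with hx₀
  have hx₀0 : 0 < x₀ := lt_min one_pos (by positivity)
  have hsub : ∀ x ∈ Set.Icc x₀ 1, x ∈ Set.Ioc (0 : ℝ) 1 := fun x hx =>
    ⟨hx₀0.trans_le hx.1, hx.2⟩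
  obtain ⟨τ, hτ⟩ : ∃ τ, IsGoodFlow p a τ := by
    refine exists_goodFlow (x₀ := x₀) (r₀ := r₀) (κ := Real.exp (δ * m)) (n := M) ha0 (fun s => ?_)
      hp0 hr1 hx₀0.le (min_le_left _ _) ?_ (fun x hx => hpow x (hsub x hx)) ?_
    · have : ((s : ℤ) : ℝ) ≤ m := by exact_mod_cast (Finset.mem_Ico.1 s.2).2.le
      exact Real.exp_le_exp.2 (mul_le_mul_of_nonneg_left this hδ.le)
    · rw [Real.log_exp]
      have h1 : x₀ * (2 * (δ * m + 1)) ≤ Real.log r₀ :=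
        (le_div_iff₀ (by positivity)).1 (min_le_right _ _)
      nlinarith
    · intro x hx u r hu hur
      have hx' := hsub x hx
      have hr : 0 ≤ r := by
        obtain ⟨j⟩ := hd
        have h1 : 0 ≤ (u ᵥ* symbolMatrix p a x) j := by
          rw [vecMul, dotProduct]
          exact Finset.sum_nonneg fun i _ =>
            mul_nonneg (hu i).le ((hsc x i j).trans (hB x hx' i j))
        rw [hur] at h1
        exact nonneg_of_mul_nonneg_left h1 (hu j)
      -- The symbol matrix dominates `(1 - ε) m(x)`, so its left Perron vector bounds the
      -- eigenvalues of `m(x)`; hence `r ≥ (1 - ε) * λ = r₀`.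
      have h1 : largestEigenvalue (momentMatrix η P' x) ≤ r / (1 - ε) := by
        refine largestEigenvalue_le (momentMatrix_nonneg h0 x) hu (div_nonneg hr hε2.le) fun j => ?_
        rw [div_mul_eq_mul_div, le_div_iff₀ hε2]
        calc (u ᵥ* momentMatrix η P' x) j * (1 - ε)
            = ∑ i, u i * ((1 - ε) • momentMatrix η P' x) i j := by
              simp only [vecMul, dotProduct, Finset.sum_mul, Matrix.smul_apply, smul_eq_mul]
              exact Finset.sum_congr rfl fun i _ => by ring
          _ ≤ (u ᵥ* symbolMatrix p a x) j := Finset.sum_le_sum fun i _ =>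
              mul_le_mul_of_nonneg_left (hB x hx' i j) (hu i).le
          _ = r * u j := by rw [hur, Pi.smul_apply, smul_eq_mul]
      have h2 := (lam_le_largestEigenvalue hlam (Set.Ioc_subset_Icc_self hx')).trans h1
      rw [le_div_iff₀ hε2, mul_comm] at h2
      rw [← hε1]
      exact h2
  obtain ⟨c, hc⟩ := hτ.exists_nat hp0
  refine ⟨S, fun s => cell δ s, a, c, fun s => measurableSet_cell δ s,
    fun s s' h => cell_disjoint hδ fun h' => h (Subtype.ext h'), ha0, fun s z hz => hz.1, hc, ?_⟩
  intro i j
  -- Strong connectivity is inherited from the symbol matrix at `x = 1`, since `c` and `p` have the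
  -- same support.
  obtain ⟨l, h1, h2⟩ := exists_walk_of_pow_pos
    (fun i j => (hsc 1 i j).trans (hB 1 (by simp) i j)) M (hpow 1 (by simp) i j)
  refine ⟨l, h1, fun i j h3 => h2 i j ?_⟩
  rw [symbolMatrix, of_apply]
  refine Finset.sum_eq_zero fun s _ => ?_
  have h4 : p i j s = 0 := (hc.2.1 i j s).1
    (Nat.cast_eq_zero.2 (Finset.sum_eq_zero_iff.1 h3 s (Finset.mem_univ s)))
  rw [h4, zero_mul]

end Moments

/-! ### The bound along a path of the subtree, and the conclusion -/

lemma IsGoodFlow.balanced_nat {d : ℕ} {S : Type*} [Fintype S] {p : Fin d → Fin d → S → ℝ}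
    {a : S → ℝ} {c : Fin d → Fin d → S → ℕ}
    (h : IsGoodFlow p a (fun i j s => (c i j s : ℝ))) (i : Fin d) :
    ∑ j, Matrix.of (fun i j => ∑ s, c i j s) i j =
      ∑ j, Matrix.of (fun i j => ∑ s, c i j s) j i := by
  have h1 := h.2.2.1 i
  simp only [Matrix.of_apply] at h1 ⊢
  exact_mod_cast h1

/-- The lower bound for the probability that the product of the edge variables along a long path of
the subtree is large, from the numerical bounds for the numbers `c i j s` of edges of type `(i, j)`
with variable in the cell of `s`. -/
lemma exists_real_prob_gt {d : ℕ} {Ω' Ω : Type*} [MeasurableSpace Ω'] {P' : Measure Ω'}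
    [MeasurableSpace Ω] {P : Measure Ω} [IsProbabilityMeasure P] [IsProbabilityMeasure P']
    {η : Fin d → Fin d → Ω' → ℝ} {S : Type*} [Fintype S] [DecidableEq S] {I : S → Set ℝ}
    {a : S → ℝ} {c : Fin d → Fin d → S → ℕ}
    (hI : ∀ s, MeasurableSet (I s)) (hdisj : ∀ s s', s ≠ s' → Disjoint (I s) (I s'))
    (ha : ∀ s, 0 < a s) (hIa : ∀ s, ∀ z ∈ I s, a s ≤ z)
    {b q : ℝ} (hb : 0 < b) (hq : 0 < q) (hba : ∀ s, b ≤ a s)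
    (hqp : ∀ i j s, c i j s ≠ 0 → q ≤ P'.real (η i j ⁻¹' I s))
    {γ : ℕ} (hγ : 1 ≤ γ) (hγc : γ = ∑ x : (Fin d × Fin d) × S, c x.1.1 x.1.2 x.2)
    {α : Fin d} {ξ : Vertex d → Ω → ℝ} (hξ : IsEdgeEnvironment α η P' ξ P) {y ψ : ℝ} {k : ℕ}
    (hy : y ^ (γ * (k + 1)) <
        (∏ x : (Fin d × Fin d) × S, a x.2 ^ (k * c x.1.1 x.1.2 x.2)) * b ^ γ)
    (hψ : ψ * ∏ x : (Fin d × Fin d) × S, ((k * c x.1.1 x.1.2 x.2).factorial : ℝ) <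
        (∏ τ : Fin d × Fin d, ((∑ s, k * c τ.1 τ.2 s).factorial : ℝ)) *
          (∏ x : (Fin d × Fin d) × S,
            P'.real (η x.1.1 x.1.2 ⁻¹' I x.2) ^ (k * c x.1.1 x.1.2 x.2)) * q ^ γ)
    {u v : Vertex d} (hv : v ∈ subtree α γ (Matrix.of fun i j => ∑ s, c i j s)) (huv : u <+: v)
    (hlen : v.length = u.length + (k + 1) * γ) :
    ψ < P.real {ω | y ^ (γ * (k + 1)) < pathProd ξ u v ω} := by
  classical
  have hcount := edgeCount_of_mem_subtree hγ hv hlen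
  obtain ⟨l, rfl⟩ := huv
  have hll : l.length = (k + 1) * γ := by
    rw [List.length_append] at hlen
    lia
  have hid := hξ.identDistrib_stepVar u l
  have hreal : ∀ (m : Fin l.length) {s : Set ℝ}, MeasurableSet s →
      P.real (stepVar ξ u l m ⁻¹' s) =
        P'.real (η (stepType α u l m).1 (stepType α u l m).2 ⁻¹' s) := by
    intro m s hs
    rw [measureReal_def, measureReal_def, (hid m).measure_mem_eq hs]
  -- This handles the `γ` edges outside the counted blocks: a type met on the path has a positive
  -- entry in `ν`, so some cell used by `c` has probability at least `q` and lies in `[b, ∞)`.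
  have hqb : ∀ m, q ≤ P.real (stepVar ξ u l m ⁻¹' Set.Ici b) := by
    intro m
    have h1 : edgeCount α u (u ++ l) (stepType α u l m).1 (stepType α u l m).2 ≠ 0 := by
      rw [← card_stepType]
      exact (Finset.card_pos.2 ⟨m, by simp⟩).ne'
    have h2 := mt (hcount (stepType α u l m).1 (stepType α u l m).2).2 h1
    rw [Matrix.of_apply] at h2
    obtain ⟨s, -, hs⟩ := Finset.exists_ne_zero_of_sum_ne_zero h2
    refine (hqp _ _ s hs).trans ?_
    rw [← hreal m (hI s)]
    exact measureReal_mono (Set.preimage_mono fun z hz => (hba s).trans (hIa s z hz))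
  have hmain := factorial_mul_le_real_prod (hξ.iIndepFun_stepVar u l)
    (fun m => (hid m).aemeasurable_fst) (stepType α u l) hI hdisj ha hIa
    (p := fun x => P'.real (η x.1.1 x.1.2 ⁻¹' I x.2)) (fun m s => hreal m (hI s)) hb hq.le hqb
    Finset.univ (fun x => k * c x.1.1 x.1.2 x.2) γ
    (by
      rintro ⟨i, j⟩
      rw [card_stepType, ← Finset.mul_sum]
      exact (hcount i j).1)
    (by
      rw [Finset.card_univ, Fintype.card_fin, hll, ← Finset.mul_sum, ← hγc]
      ring)
  have hF : 0 < ∏ x : (Fin d × Fin d) × S, ((k * c x.1.1 x.1.2 x.2).factorial : ℝ) :=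
    Finset.prod_pos fun x _ => by positivity
  have h3 := hψ.trans_le hmain
  rw [mul_comm] at h3
  refine (lt_of_mul_lt_mul_left h3 hF.le).trans_le (measureReal_mono fun ω hω => ?_)
  rw [Set.mem_ofPred_eq, pathProd_append]
  exact hy.trans_le hω

end ColouredTree

theorem mainTheorem4 {d : ℕ} {Ω' : Type*} [MeasurableSpace Ω'] (P' : Measure Ω')
    [IsProbabilityMeasure P'] (η : Fin d → Fin d → Ω' → ℝ)
    (hη_nonneg : ∀ i j, ∀ᵐ ω ∂P', 0 ≤ η i j ω)
    (hη_int : ∀ i j, Integrable (η i j) P')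
    (hη_reg : ColouredTree.IsRegular η P')
    (hlam : 1 < ColouredTree.lam η P') :
    ∃ (β : Matrix (Fin d) (Fin d) ℚ) (N γ : ℕ) (ν : Matrix (Fin d) (Fin d) ℕ) (y : ℝ),
      ColouredTree.IsDirection (β.map (fun q : ℚ => (q : ℝ))) ∧
      1 ≤ N ∧ 1 ≤ γ ∧ (∀ i j, (ν i j : ℚ) = β i j * (γ : ℚ)) ∧
      0 < y ∧ y ≤ 1 ∧
      ∀ α : Fin d,
        (ColouredTree.subtree α γ ν).Infinite ∧
        ∀ {Ω : Type*} [MeasurableSpace Ω] (P : Measure Ω) [IsProbabilityMeasure P]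
          (ξ : ColouredTree.Vertex d → Ω → ℝ),
          ColouredTree.IsEdgeEnvironment α η P' ξ P →
          ∀ k : ℕ, N ≤ k →
            ∀ u ∈ ColouredTree.subtree α γ ν, ∀ v ∈ ColouredTree.subtree α γ ν,
              u <+: v → v.length = u.length + k * γ →
              P.real {ω | y ^ (γ * k) < ColouredTree.pathProd ξ u v ω} >
                (1 / (y * ColouredTree.psi (β.map (fun q : ℚ => (q : ℝ))))) ^ (γ * k) := by
  obtain ⟨S, I, a, c₀, hI, hdisj, ha, hIa, hgood₀, hwalk⟩ :=
    ColouredTree.exists_discrete_flow hη_nonneg hη_int hη_reg hlam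
  obtain ⟨q₀, hq₀, hW⟩ := ColouredTree.exists_eulerian_walk
    (ν := Matrix.of fun i j => ∑ s, c₀ i j s)
    hgood₀.balanced_nat hwalk
  -- Scaling keeps the flow good and makes `ν` the step count of a closed walk from every colour, so
  -- that every root colour is covered.
  set c : Fin d → Fin d → S → ℕ := fun i j s => q₀ * c₀ i j s with hc
  set p : Fin d → Fin d → S → ℝ := fun i j s => P'.real (η i j ⁻¹' I s)
  have hgood : ColouredTree.IsGoodFlow p a (fun i j s => (c i j s : ℝ)) := by
    simpa [hc] using hgood₀.smul (D := q₀) (by exact_mod_cast hq₀)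
  set ν : Matrix (Fin d) (Fin d) ℕ := Matrix.of fun i j => ∑ s, c i j s with hν
  have hν₀ : q₀ • (Matrix.of fun i j => ∑ s, c₀ i j s) = ν := by
    ext i j
    simp [hν, hc, Finset.mul_sum]
  set γ : ℕ := ∑ x : (Fin d × Fin d) × S, c x.1.1 x.1.2 x.2 with hγc
  have hγν : γ = ∑ i, ∑ j, ν i j := by
    simp [hγc, hν, Fintype.sum_prod_type]
  have hγ : 1 ≤ γ := by
    rw [Nat.one_le_iff_ne_zero]
    intro h
    have h1 : ∀ i j s, c i j s = 0 := fun i j s =>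
      Finset.sum_eq_zero_iff.1 h ((i, j), s) (Finset.mem_univ _)
    have h2 := hgood.2.2.2.1
    simp [ColouredTree.flowEntropy, h1] at h2
  have hγ0 : (γ : ℚ) ≠ 0 := by positivity
  set β : Matrix (Fin d) (Fin d) ℚ := Matrix.of fun i j => (ν i j : ℚ) / γ with hβ
  have hβ' : ∀ i j, β.map (fun q : ℚ => (q : ℝ)) i j = (∑ s, c i j s : ℕ) / γ := by
    intro i j
    simp [hβ, hν]
  obtain ⟨b, hb, hba⟩ := ColouredTree.exists_pos_le a
  obtain ⟨q, hq, hqp⟩ := ColouredTree.exists_pos_le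
    fun x : (Fin d × Fin d) × S => p x.1.1 x.1.2 x.2
  obtain ⟨y, hy0, hy1, N, hN, hrate⟩ := hgood.exists_rate (fun i j s => measureReal_nonneg)
    ha hb hq hγ hγc hβ'
  have hbal : ∀ i, ∑ j, ν i j = ∑ j, ν j i := hgood.balanced_nat
  -- The rate estimate counts the `k` complete blocks in a path of length `(k + 1) * γ`, hence the
  -- shift to `N + 1`.
  refine ⟨β, N + 1, γ, ν, y, ⟨fun i j => ?_, ?_, fun i => ?_⟩, by lia, hγ, fun i j => ?_, hy0, hy1,
    fun α => ⟨?_, ?_⟩⟩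
  · rw [hβ']
    positivity
  · simp only [hβ', ← Finset.sum_div]
    rw [div_eq_one_iff_eq (by positivity), hγν]
    push_cast [hν, Matrix.of_apply]
    rfl
  · simp only [hβ', ← Finset.sum_div]
    congr 1
    exact_mod_cast hbal i
  · rw [hβ, Matrix.of_apply, div_mul_cancel₀ _ hγ0]
  · obtain ⟨W, hW1, hW2⟩ := hW α
    rw [hν₀] at hW2
    refine ColouredTree.subtree_infinite hγ hW1 ?_ hW2
    rw [← ColouredTree.stepCount_sum α, hW2, hγν]
  · intro Ω _ P _ ξ hξ k hk u _ v hv huv hlen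
    obtain ⟨k, rfl⟩ : ∃ k', k = k' + 1 := ⟨k - 1, by lia⟩
    obtain ⟨h1, h2⟩ := hrate k (by lia)
    refine ColouredTree.exists_real_prob_gt hI hdisj ha hIa hb hq (fun s => hba s (ha s))
      (fun i j s h0 => hqp ((i, j), s) ?_) hγ hγc hξ h1 h2 hv huv hlen
    exact measureReal_nonneg.lt_of_ne fun h => h0 (Nat.cast_eq_zero.1 ((hgood.2.1 i j s).2 h.symm))
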